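/- Let $d\ge 1$ be an integer. For an algebraic integer $\alpha$ of degree $d$ (over $\mathbb{Q}$), label its Galois conjugates as $\alpha_0,\dots,\alpha_{d-1}$ so that $|\alpha_0|\ge|\alpha_1|\ge\cdots\ge|\alpha_{d-1}|$. For positive integers $k<d$, let $E_{k,d}$ be the set of all $(c_1,\dots,c_k)\in(\mathbb{R}_{\ge 0})^k$ such that $|\alpha_0||\alpha_1|^{c_1}\cdots|\alpha_k|^{c_k}\ge 1$ for every algebraic integer $\alpha$ of degree $d$. The height of a polynomial with integer coefficients is the maximum of the absolute values of its coefficients. There exists a constant $C>0$ depending only on $d$ such that the following holds. Let $k$ be a positive integer with $d>3k$, and put $$\mu=\left\lceil\frac{\lceil d/3\rceil-k}{2}\right\rceil,\qquad \mathcal{E}=\max\left\{2(d-1)(d-2),\ \frac{(d-1)(d-2)(d-3)}{2\mu}\right\}.$$ Then for every algebraic integer $\alpha$ of degree $d$ that is not a root of unity and for every $(c_1,\dots,c_k)\in E_{k,d}$, we have $$|\alpha_0||\alpha_1|^{c_1}\cdots|\alpha_k|^{c_k} > 1 + C\,H^{-\mathcal{E}+1/(k(d-1))},$$ where $H$ is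 the height of the minimal polynomial of $\alpha$. In particular, $|\alpha_0||\alpha_1|^{c_1}\cdots|\alpha_k|^{c_k}>1$. -/

import Mathlib

open Polynomial

/-- `a 0, …, a (d - 1)` is a labelling of the Galois conjugates of `α` (the complex roots of its
minimal polynomial over `ℚ`, each listed once) with `|a 0| ≥ |a 1| ≥ ⋯ ≥ |a (d - 1)|`. -/
structure IsConjugateLabelling (α : ℂ) {d : ℕ} (a : Fin d → ℂ) : Prop where
  map_eq_roots : (Finset.univ : Finset (Fin d)).val.map a = (minpoly ℚ α).aroots ℂ
  antitone_norm : Antitone fun i => ‖a i‖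

/-- The product `|a 0| |a 1| ^ c₁ ⋯ |a k| ^ c_k`; the real number `c_j` is `c ⟨j - 1, _⟩`. -/
noncomputable def weightedProduct {k d : ℕ} (hkd : k < d) (c : Fin k → ℝ) (a : Fin d → ℂ) : ℝ :=
  ‖a (Fin.castLE hkd 0)‖ * ∏ j : Fin k, ‖a (Fin.castLE hkd j.succ)‖ ^ c j

/-- The set `E_{k,d}` of all tuples `(c₁, …, c_k)` of nonnegative reals such that
`|α₀| |α₁| ^ c₁ ⋯ |α_k| ^ c_k ≥ 1` for every algebraic integer `α` of degree `d`. -/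
def exponentSet {k d : ℕ} (hkd : k < d) : Set (Fin k → ℝ) :=
  {c | (∀ j, 0 ≤ c j) ∧
    ∀ α : ℂ, IsIntegral ℤ α → (minpoly ℚ α).natDegree = d →
      ∀ a : Fin d → ℂ, IsConjugateLabelling α a → 1 ≤ weightedProduct hkd c a}

/-- The height of an integer polynomial: the maximum of the absolute values of its coefficients. -/
def polyHeight (p : ℤ[X]) : ℕ :=
  (Finset.range (p.natDegree + 1)).sup fun i => (p.coeff i).natAbs

/-- `μ = ⌈(⌈d/3⌉ - k)/2⌉`. -/
def muConst (k d : ℕ) : ℤ :=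
  ⌈((⌈(d : ℚ) / 3⌉ : ℚ) - (k : ℚ)) / 2⌉

/-- `max {2(d-1)(d-2), (d-1)(d-2)(d-3)/(2μ)}`. -/
noncomputable def mainExponent (k d : ℕ) : ℝ :=
  max (2 * ((d : ℝ) - 1) * ((d : ℝ) - 2))
    (((d : ℝ) - 1) * ((d : ℝ) - 2) * ((d : ℝ) - 3) / (2 * (muConst k d : ℝ)))

/-! Write x_i = log |α_i|. The trinomials X^d + 2n X^(d-m) + 2 have about m conjugates of size
n^(1/m) and d - m of size n^(-1/(d-m)). Testing a tuple of E_{k,d} on them and letting n → ∞ gives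
m(1 + c_1 + ⋯ + c_k) ≤ d(1 + c_1 + ⋯ + c_{m-1}) for 1 ≤ m ≤ k (`exponentSet_inequality`). Abel
summation turns these inequalities into: log |N(α)| + (x_k - x_{d-1}) is at most d times the
logarithm of the weighted product (`sum_add_sub_le_log_weightedProduct`). Since N(α) is a nonzero
integer, only units remain, and for them the spread g = x_k - x_{d-1} must be bounded below.

If more than 2d/3 conjugates share an absolute value that is at most |α_k|, that value is at least 1
(`one_le_of_card_norm_eq`). Hence g ≥ -x_{d-1}, and this is bounded below by the theorems of
Northcott and Kronecker. Otherwise many pairs among the d - k smallest conjugates have distinct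
absolute values. For each such pair |α_i|² - |α_j|² is a nonzero integral polynomial in the
conjugates, because complex conjugation permutes them, and for g ≤ 1/4 its size is at most 4g
exp(2x_{d-1}). The product of all nonzero expressions of the same shape is a nonzero integer, so a
tiny g forces a large Mahler measure M (`card_mul_neg_log_le`, `neg_log_le`).

The exponent is the weight of log M in that product divided by the number of small factors. The
factor exp(2x_{d-1}) ≤ M^(-2/d) saves 2/d ≥ 1/(k(d-1)), and M ≤ √(d+1) H brings in the height. -/

namespace IsConjugateLabelling

variable {α : ℂ} {d : ℕ} {a : Fin d → ℂ}

/-! ### Conjugates as the simple roots of the minimal polynomial -/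

theorem injective (h : IsConjugateLabelling α a) (hα : IsIntegral ℤ α) : Function.Injective a := by
  have hsep : ((minpoly ℚ α).map (algebraMap ℚ ℂ)).Separable :=
    (minpoly.irreducible hα.tower_top).separable.map
  have hnd : ((Finset.univ : Finset (Fin d)).val.map a).Nodup := by
    rw [h.map_eq_roots]
    exact nodup_roots hsep
  intro i j hij
  exact Multiset.inj_on_of_nodup_map hnd i (Finset.mem_univ i) j (Finset.mem_univ j) hij

theorem aeval_eq_zero_iff (h : IsConjugateLabelling α a) (hα : IsIntegral ℤ α) {z : ℂ} :
    aeval z (minpoly ℚ α) = 0 ↔ ∃ i, a i = z := by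
  have hne : minpoly ℚ α ≠ 0 := minpoly.ne_zero hα.tower_top
  have : z ∈ (minpoly ℚ α).aroots ℂ ↔ ∃ i, a i = z := by
    rw [← h.map_eq_roots]; simp
  rw [← this, mem_aroots]
  exact ⟨fun h => ⟨hne, h⟩, fun h => h.2⟩

theorem isIntegral (h : IsConjugateLabelling α a) (hα : IsIntegral ℤ α) (i : Fin d) :
    IsIntegral ℤ (a i) := by
  refine ⟨minpoly ℤ α, minpoly.monic hα, ?_⟩
  have := (h.aeval_eq_zero_iff hα).2 ⟨i, rfl⟩
  rw [minpoly.isIntegrallyClosed_eq_field_fractions' ℚ hα, aeval_map_algebraMap] at this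
  exact this

theorem map_minpoly (h : IsConjugateLabelling α a) (hα : IsIntegral ℤ α) :
    (minpoly ℤ α).map (Int.castRingHom ℂ) = ∏ i, (X - C (a i)) := by
  have h1 : (minpoly ℤ α).map (Int.castRingHom ℂ) = (minpoly ℚ α).map (algebraMap ℚ ℂ) := by
    rw [minpoly.isIntegrallyClosed_eq_field_fractions' ℚ hα, Polynomial.map_map]
    congr 1
  have hm : ((minpoly ℚ α).map (algebraMap ℚ ℂ)).Monic :=
    (minpoly.monic hα.tower_top).map _
  rw [h1, (IsAlgClosed.splits ((minpoly ℚ α).map (algebraMap ℚ ℂ))).eq_prod_roots_of_monic hm]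
  have := h.map_eq_roots
  rw [aroots_def] at this
  rw [← this, Multiset.map_map]
  rfl

end IsConjugateLabelling

/-! ### Galois action on the labels, and integrality of invariant expressions -/

/-- A permutation of the labels that preserves all integral polynomial relations among the `a i`. -/
def IsGaloisPerm {d : ℕ} (a : Fin d → ℂ) (π : Equiv.Perm (Fin d)) : Prop :=
  ∀ Q : MvPolynomial (Fin d) ℤ,
    MvPolynomial.aeval a Q = 0 ↔ MvPolynomial.aeval (a ∘ π) Q = 0

/-- Every automorphism of the splitting field inside ℂ permutes the labels and respects polynomial
relations, so the value is fixed by the Galois group and hence rational. It is also an algebraic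
integer. Later arguments only see `IsGaloisPerm` and never the splitting field. -/
theorem IsConjugateLabelling.exists_int_eq {α : ℂ} {d : ℕ} {a : Fin d → ℂ}
    (h : IsConjugateLabelling α a) (hα : IsIntegral ℤ α) (Q : MvPolynomial (Fin d) ℤ)
    (hQ : ∀ π, IsGaloisPerm a π → MvPolynomial.aeval (a ∘ π) Q = MvPolynomial.aeval a Q) :
    ∃ n : ℤ, MvPolynomial.aeval a Q = (n : ℂ) := by
  set p := minpoly ℚ α with hp
  have hirr : Irreducible p := minpoly.irreducible hα.tower_top
  let L := IntermediateField.adjoin ℚ (p.rootSet ℂ)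
  have hspl : (p.map (algebraMap ℚ ℂ)).Splits := IsAlgClosed.splits _
  have : p.IsSplittingField ℚ L := IntermediateField.adjoin_rootSet_isSplittingField hspl
  have : IsGalois ℚ L := IsGalois.of_separable_splitting_field hirr.separable
  have : FiniteDimensional ℚ L := IsSplittingField.finiteDimensional L p
  have hroot : ∀ i, a i ∈ p.rootSet ℂ := fun i => by
    rw [mem_rootSet]
    exact ⟨hirr.ne_zero, (h.aeval_eq_zero_iff hα).2 ⟨i, rfl⟩⟩
  let b : Fin d → L := fun i => ⟨a i, IntermediateField.subset_adjoin ℚ _ (hroot i)⟩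
  have hb : ∀ i, ((b i : L) : ℂ) = a i := fun i => rfl
  have hbinj : Function.Injective b := fun i j hij =>
    h.injective hα (by rw [← hb i, ← hb j, hij])
  have haev : ∀ (c : Fin d → L) (R : MvPolynomial (Fin d) ℤ),
      ((MvPolynomial.aeval c R : L) : ℂ) = MvPolynomial.aeval (fun i => (c i : ℂ)) R := by
    intro c R
    have := MvPolynomial.map_aeval (R := ℤ) c (algebraMap L ℂ) R
    rw [show (algebraMap L ℂ) (MvPolynomial.aeval c R)
      = ((MvPolynomial.aeval c R : L) : ℂ) from rfl] at this
    rw [this, MvPolynomial.aeval_def, MvPolynomial.coe_eval₂Hom]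
    congr 1
  have hperm : ∀ σ : L ≃ₐ[ℚ] L, ∃ π : Equiv.Perm (Fin d), ∀ i, σ (b i) = b (π i) := by
    intro σ
    have hex : ∀ i, ∃ j, σ (b i) = b j := by
      intro i
      have h0 : aeval (b i) p = 0 := by
        have h1 := (h.aeval_eq_zero_iff hα).2 ⟨i, rfl⟩
        have h2 := Polynomial.aeval_algebraMap_apply ℂ (b i) p
        rw [show (algebraMap L ℂ) (b i) = a i from rfl, h1] at h2
        exact (map_eq_zero_iff _ (algebraMap L ℂ).injective).1 h2.symm
      have h3 : aeval (σ (b i)) p = 0 := by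
        have := Polynomial.aeval_algHom_apply (σ : L →ₐ[ℚ] L) (b i) p
        rw [h0, map_zero] at this
        exact this
      have h4 : aeval ((σ (b i) : L) : ℂ) p = 0 := by
        have h2 := Polynomial.aeval_algebraMap_apply ℂ (σ (b i)) p
        rw [h3, map_zero] at h2
        exact h2
      obtain ⟨j, hj⟩ := (h.aeval_eq_zero_iff hα).1 h4
      exact ⟨j, Subtype.ext hj.symm⟩
    choose f hf using hex
    have hfinj : Function.Injective f := fun i j hij => by
      apply hbinj
      apply σ.injective
      rw [hf, hf, hij]
    refine ⟨Equiv.ofBijective f (Finite.injective_iff_bijective.1 hfinj), fun i => ?_⟩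
    rw [hf]; rfl
  have hmap : ∀ (σ : L ≃ₐ[ℚ] L) (π : Equiv.Perm (Fin d)), (∀ i, σ (b i) = b (π i)) →
      ∀ R : MvPolynomial (Fin d) ℤ, σ (MvPolynomial.aeval b R) = MvPolynomial.aeval (b ∘ π) R := by
    intro σ π hπ R
    have := MvPolynomial.map_aeval (R := ℤ) b (σ : L →+* L) R
    rw [show ((σ : L →+* L)) (MvPolynomial.aeval b R) = σ (MvPolynomial.aeval b R) from rfl] at this
    rw [this, MvPolynomial.aeval_def, MvPolynomial.coe_eval₂Hom]
    have e : (fun i => (σ : L →+* L) (b i)) = b ∘ π := by ext1 i; exact hπ i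
    rw [e]
    congr 1
    exact RingHom.ext_int _ _
  have hval : ∀ R : MvPolynomial (Fin d) ℤ,
      ((MvPolynomial.aeval b R : L) : ℂ) = MvPolynomial.aeval a R := fun R => haev b R
  have hfix : ∀ σ : L ≃ₐ[ℚ] L, σ (MvPolynomial.aeval b Q) = MvPolynomial.aeval b Q := by
    intro σ
    obtain ⟨π, hπ⟩ := hperm σ
    have hG : IsGaloisPerm a π := by
      intro R
      have e1 := hmap σ π hπ R
      have e2 : ((MvPolynomial.aeval (b ∘ π) R : L) : ℂ) = MvPolynomial.aeval (a ∘ π) R :=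
        haev _ R
      rw [← e2, ← e1, ← hval R]
      simp
    rw [hmap σ π hπ]
    apply Subtype.ext
    rw [hval, ← hQ π hG]
    exact haev _ Q
  obtain ⟨q, hq⟩ := (IsGalois.mem_range_algebraMap_iff_fixed (F := ℚ) (E := L) _).2 hfix
  have hq' : (algebraMap ℚ ℂ) q = MvPolynomial.aeval a Q := by
    rw [← hval, ← hq]; rfl
  have hint : IsIntegral ℤ (MvPolynomial.aeval a Q) := by
    have : MvPolynomial.aeval a Q ∈ integralClosure ℤ ℂ := by
      have h1 : MvPolynomial.aeval a Q ∈ Algebra.adjoin ℤ (Set.range a) := by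
        rw [Algebra.adjoin_range_eq_range_aeval]; exact ⟨Q, rfl⟩
      refine (Algebra.adjoin_le ?_ : Algebra.adjoin ℤ (Set.range a) ≤ integralClosure ℤ ℂ) h1
      rintro _ ⟨i, rfl⟩
      exact h.isIntegral hα i
    exact this
  rw [← hq'] at hint
  have hint' : IsIntegral ℤ q := (isIntegral_algebraMap_iff (algebraMap ℚ ℂ).injective).1 hint
  obtain ⟨n, hn⟩ := IsIntegrallyClosed.isIntegral_iff.1 hint'
  refine ⟨n, ?_⟩
  rw [← hq', ← hn]
  simp

theorem IsConjugateLabelling.one_le_norm {α : ℂ} {d : ℕ} {a : Fin d → ℂ}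
    (h : IsConjugateLabelling α a) (hα : IsIntegral ℤ α) (Q : MvPolynomial (Fin d) ℤ)
    (hQ : ∀ π, IsGaloisPerm a π → MvPolynomial.aeval (a ∘ π) Q = MvPolynomial.aeval a Q)
    (h0 : MvPolynomial.aeval a Q ≠ 0) : 1 ≤ ‖MvPolynomial.aeval a Q‖ := by
  obtain ⟨n, hn⟩ := h.exists_int_eq hα Q hQ
  rw [hn] at h0 ⊢
  have : n ≠ 0 := by rintro rfl; simp at h0
  rw [Complex.norm_intCast]
  exact_mod_cast Int.one_le_abs this

/-- The product of a family of integral polynomial expressions over a set of indices on which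
the Galois permutations act compatibly is, if nonzero, at least `1` in absolute value. -/
theorem IsConjugateLabelling.one_le_norm_prod {α : ℂ} {d : ℕ} {a : Fin d → ℂ}
    (h : IsConjugateLabelling α a) (hα : IsIntegral ℤ α) {ι : Type*} [Fintype ι]
    (act : Equiv.Perm (Fin d) → ι → ι) (hact : ∀ π, Function.Injective (act π))
    (F : ι → MvPolynomial (Fin d) ℤ)
    (hF : ∀ (π : Equiv.Perm (Fin d)) t, MvPolynomial.aeval (a ∘ π) (F t) = MvPolynomial.aeval a (F (act π t)))
    (T : Finset ι) (hT : ∀ π, IsGaloisPerm a π → ∀ t ∈ T, act π t ∈ T)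
    (h0 : ∀ t ∈ T, MvPolynomial.aeval a (F t) ≠ 0) :
    1 ≤ ∏ t ∈ T, ‖MvPolynomial.aeval a (F t)‖ := by
  classical
  have key := h.one_le_norm hα (∏ t ∈ T, F t) ?_ ?_
  · rwa [map_prod, norm_prod] at key
  · intro π hπ
    rw [map_prod, map_prod]
    simp_rw [hF]
    -- A Galois permutation only reorders the factors of the product.
    have himg : T.image (act π) = T := by
      apply Finset.eq_of_subset_of_card_le
      · intro t ht
        obtain ⟨s, hs, rfl⟩ := Finset.mem_image.1 ht
        exact hT π hπ s hs
      · rw [Finset.card_image_of_injective _ (hact π)]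
    conv_rhs => rw [← himg]
    rw [Finset.prod_image fun x _ y _ hxy => hact π hxy]
  · rw [map_prod]
    exact Finset.prod_ne_zero_iff.2 h0

/-! ### Norm, complex conjugation, Mahler measure and height -/

namespace IsConjugateLabelling

variable {α : ℂ} {d : ℕ} {a : Fin d → ℂ}

theorem ne_zero (h : IsConjugateLabelling α a) (hα : IsIntegral ℤ α) (h0 : α ≠ 0) (i : Fin d) :
    a i ≠ 0 := by
  intro hi
  have h1 := (h.aeval_eq_zero_iff hα).2 ⟨i, hi⟩
  rw [← coeff_zero_eq_aeval_zero', map_eq_zero_iff _ (algebraMap ℚ ℂ).injective] at h1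
  exact minpoly.coeff_zero_ne_zero hα.tower_top h0 h1

theorem sum_log_norm (h : IsConjugateLabelling α a) (hα : IsIntegral ℤ α) (h0 : α ≠ 0) :
    ∑ i, Real.log ‖a i‖ = 0 ∨ Real.log 2 ≤ ∑ i, Real.log ‖a i‖ := by
  have hne : ∀ i ∈ Finset.univ, ‖a i‖ ≠ 0 := fun i _ => norm_ne_zero_iff.2 (h.ne_zero hα h0 i)
  obtain ⟨n, hn⟩ := h.exists_int_eq hα (∏ i, MvPolynomial.X i) (by
    intro π _
    simp only [map_prod, MvPolynomial.aeval_X, Function.comp]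
    exact Equiv.prod_comp π a)
  simp only [map_prod, MvPolynomial.aeval_X] at hn
  have hn' : ∏ i, ‖a i‖ = |(n : ℝ)| := by
    rw [← norm_prod, hn, Complex.norm_intCast]
  have hn0 : n ≠ 0 := by
    rintro rfl
    simp only [Int.cast_zero, abs_zero] at hn'
    exact Finset.prod_ne_zero_iff.2 hne hn'
  rw [← Real.log_prod hne, hn']
  have h1 : 1 ≤ |n| := Int.one_le_abs hn0
  rcases h1.eq_or_lt with h2 | h2
  · left
    rw [← Int.cast_abs, ← h2]; simp
  · right
    apply Real.log_le_log (by norm_num)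
    rw [← Int.cast_abs]
    exact_mod_cast h2

theorem exists_conj (h : IsConjugateLabelling α a) (hα : IsIntegral ℤ α) :
    ∃ τ : Equiv.Perm (Fin d), ∀ i, a (τ i) = (starRingEnd ℂ) (a i) := by
  have hex : ∀ i, ∃ j, a j = (starRingEnd ℂ) (a i) := by
    intro i
    rw [← h.aeval_eq_zero_iff hα]
    have h1 := (h.aeval_eq_zero_iff hα).2 ⟨i, rfl⟩
    have h2 := Polynomial.hom_eval₂ (minpoly ℚ α) (algebraMap ℚ ℂ) (starRingEnd ℂ) (a i)
    rw [← aeval_def, h1, map_zero, RingHom.ext_rat ((starRingEnd ℂ).comp (algebraMap ℚ ℂ))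
      (algebraMap ℚ ℂ)] at h2
    exact h2.symm
  choose f hf using hex
  have hinj : Function.Injective f := fun i j hij => h.injective hα
    ((starRingEnd ℂ).injective (by rw [← hf, ← hf, hij]))
  exact ⟨Equiv.ofBijective f (Finite.injective_iff_bijective.1 hinj), hf⟩

theorem mahlerMeasure_eq (h : IsConjugateLabelling α a) (hα : IsIntegral ℤ α) :
    ((minpoly ℤ α).map (Int.castRingHom ℂ)).mahlerMeasure = ∏ i, max 1 ‖a i‖ := by
  rw [mahlerMeasure_eq_leadingCoeff_mul_prod_roots, ((minpoly.monic hα).map _).leadingCoeff,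
    h.map_minpoly hα, roots_prod _ _ (Finset.prod_ne_zero_iff.2 fun i _ => X_sub_C_ne_zero _)]
  simp [List.prod_ofFn]

theorem log_mahlerMeasure_eq (h : IsConjugateLabelling α a) (hα : IsIntegral ℤ α) :
    Real.log ((minpoly ℤ α).map (Int.castRingHom ℂ)).mahlerMeasure
      = ∑ i, Real.posLog ‖a i‖ := by
  rw [h.mahlerMeasure_eq hα, Real.log_prod fun i _ => by positivity]
  refine Finset.sum_congr rfl fun i _ => ?_
  rw [Real.posLog_eq_log_max_one (norm_nonneg _)]

theorem natDegree_minpoly_int (hα : IsIntegral ℤ α) :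
    (minpoly ℤ α).natDegree = (minpoly ℚ α).natDegree := by
  rw [minpoly.isIntegrallyClosed_eq_field_fractions' ℚ hα]
  exact ((minpoly.monic hα).natDegree_map _).symm

theorem one_le_polyHeight (hα : IsIntegral ℤ α) : 1 ≤ polyHeight (minpoly ℤ α) := by
  refine le_trans ?_ (Finset.le_sup (f := fun i => ((minpoly ℤ α).coeff i).natAbs)
    (Finset.mem_range.2 (Nat.lt_succ_self (minpoly ℤ α).natDegree)))
  simp [(minpoly.monic hα).coeff_natDegree]

theorem sum_posLog_le_log_polyHeight (h : IsConjugateLabelling α a) (hα : IsIntegral ℤ α)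
    (hd : (minpoly ℚ α).natDegree = d) :
    ∑ i, Real.posLog ‖a i‖ ≤
      Real.log (polyHeight (minpoly ℤ α)) + Real.log (√(d + 1)) := by
  set p := (minpoly ℤ α).map (Int.castRingHom ℂ) with hp
  have hdeg : p.natDegree = d := by
    rw [hp, (minpoly.monic hα).natDegree_map, natDegree_minpoly_int hα, hd]
  have hH : (1 : ℝ) ≤ polyHeight (minpoly ℤ α) := by exact_mod_cast one_le_polyHeight hα
  have hsup : p.supNorm ≤ polyHeight (minpoly ℤ α) := by
    obtain ⟨i, hi⟩ := p.exists_eq_supNorm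
    rw [hi, hp, coeff_map, eq_intCast, Complex.norm_intCast, ← Int.cast_abs]
    by_cases hid : i ≤ (minpoly ℤ α).natDegree
    · have := Finset.le_sup (f := fun i => ((minpoly ℤ α).coeff i).natAbs)
        (Finset.mem_range.2 (Nat.lt_succ_of_le hid))
      rw [Int.abs_eq_natAbs]
      exact_mod_cast this
    · rw [coeff_eq_zero_of_natDegree_lt (not_le.1 hid)]
      simp
  rw [← h.log_mahlerMeasure_eq hα, ← Real.log_mul (by positivity) (by positivity)]
  apply Real.log_le_log
  · rw [h.mahlerMeasure_eq hα]; positivity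
  · refine (mahlerMeasure_le_sqrt_natDegree_add_one_mul_supNorm p).trans ?_
    rw [hdeg, mul_comm]
    gcongr

/-- By Northcott only finitely many integer polynomials of degree at most d have Mahler measure at
most 2, so the positive values of log M among them have a minimum. By Kronecker, log M vanishes only
for zero and roots of unity. -/
theorem exists_sum_posLog_gap (d : ℕ) : ∃ δ : ℝ, 0 < δ ∧ ∀ (α : ℂ), IsIntegral ℤ α → α ≠ 0 →
    (minpoly ℚ α).natDegree = d → (∀ n : ℕ, 0 < n → α ^ n ≠ 1) →
    ∀ a : Fin d → ℂ, IsConjugateLabelling α a → δ ≤ ∑ i, Real.posLog ‖a i‖ := by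
  have hfin := finite_mahlerMeasure_le d 2
  set B := {p : ℤ[X] | p.natDegree ≤ d ∧
    (p.map (Int.castRingHom ℂ)).mahlerMeasure ≤ ((2 : NNReal) : ℝ)} with hB
  let m : ℤ[X] → ℝ := fun p => Real.log (p.map (Int.castRingHom ℂ)).mahlerMeasure
  -- Inserting log 2 makes the set nonempty and covers the polynomials of measure above 2.
  have hfin2 : (insert (Real.log 2) (m '' B) ∩ Set.Ioi 0).Finite :=
    ((hfin.image m).insert _).inter_of_left _
  have hne : (insert (Real.log 2) (m '' B) ∩ Set.Ioi 0).Nonempty :=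
    ⟨Real.log 2, Set.mem_insert _ _, Real.log_pos (by norm_num)⟩
  obtain ⟨δ, hδ, hmin⟩ := Set.exists_min_image _ id hfin2 hne
  refine ⟨δ, hδ.2, fun α hα hα0 hd hroot a h => ?_⟩
  rw [← h.log_mahlerMeasure_eq hα]
  have h1 := one_le_mahlerMeasure_of_ne_zero (minpoly.monic hα).ne_zero
  have h2 : ((minpoly ℤ α).map (Int.castRingHom ℂ)).mahlerMeasure ≠ 1 := by
    intro h2
    obtain ⟨n, hn, hn1⟩ := pow_eq_one_of_mahlerMeasure_eq_one h2 hα0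
      (by rw [mem_aroots]; exact ⟨(minpoly.monic hα).ne_zero, minpoly.aeval _ _⟩)
    exact hroot n hn hn1
  have h3 := Real.log_pos (lt_of_le_of_ne h1 h2.symm)
  by_cases h4 : ((minpoly ℤ α).map (Int.castRingHom ℂ)).mahlerMeasure ≤ ((2 : NNReal) : ℝ)
  · refine hmin _ ⟨Set.mem_insert_of_mem _ ⟨minpoly ℤ α, ⟨?_, h4⟩, rfl⟩, h3⟩
    rw [natDegree_minpoly_int hα, hd]
  · refine (hmin _ ⟨Set.mem_insert _ _, Real.log_pos (by norm_num)⟩).trans ?_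
    exact Real.log_le_log (by norm_num) (not_le.1 h4).le

/-! ### Many conjugates on one circle -/

/-- If more than two thirds of the conjugates lie on a circle `|z| = ρ`, then `ρ ≥ 1`. -/
theorem one_le_of_card_norm_eq (h : IsConjugateLabelling α a) (hα : IsIntegral ℤ α) (h0 : α ≠ 0)
    {ρ : ℝ} (hρ : 2 * d < 3 * (Finset.univ.filter fun i => ‖a i‖ = ρ).card) : 1 ≤ ρ := by
  classical
  set A := Finset.univ.filter fun i => ‖a i‖ = ρ with hA
  have hne := h.ne_zero hα h0
  -- The set `T` is defined by multiplicative relations alone, so it is Galois-stable. It contains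
  -- the pairs (i, τ i) with i in `A`, since all of these have product ρ².
  let P : Fin d × Fin d → Finset (Fin d) := fun t =>
    Finset.univ.filter fun x => ∃ y, a x * a y = a t.1 * a t.2
  let T : Finset (Fin d × Fin d) := Finset.univ.filter fun t => 2 * d < 3 * (P t).card
  have hAne : A.Nonempty := by
    rw [← Finset.card_pos]; omega
  obtain ⟨i₀, hi₀⟩ := hAne
  have hρ0 : 0 ≤ ρ := by
    rw [← (Finset.mem_filter.1 hi₀).2]; exact norm_nonneg _
  obtain ⟨τ, hτ⟩ := h.exists_conj hα
  have hmul : ∀ i ∈ A, a i * a (τ i) = ((ρ ^ 2 : ℝ) : ℂ) := by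
    intro i hi
    rw [hτ, Complex.mul_conj, Complex.normSq_eq_norm_sq, (Finset.mem_filter.1 hi).2]
  have hTne : (i₀, τ i₀) ∈ T := by
    refine Finset.mem_filter.2 ⟨Finset.mem_univ _, lt_of_lt_of_le hρ ?_⟩
    have : A ⊆ P (i₀, τ i₀) := fun i hi =>
      Finset.mem_filter.2 ⟨Finset.mem_univ _, τ i, by rw [hmul i hi, hmul i₀ hi₀]⟩
    have := Finset.card_le_card this
    omega
  have hnorm : ∀ t ∈ T, ‖a t.1 * a t.2‖ = ρ ^ 2 := by
    intro t ht
    have hcard := (Finset.mem_filter.1 ht).2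
    have hP : ∀ x : Fin d, ∃ y, x ∈ P t → a x * a y = a t.1 * a t.2 := by
      intro x
      by_cases hx : x ∈ P t
      · obtain ⟨y, hy⟩ := (Finset.mem_filter.1 hx).2
        exact ⟨y, fun _ => hy⟩
      · exact ⟨x, fun hx' => absurd hx' hx⟩
    choose y hy using hP
    have hyinj : Set.InjOn y (P t) := by
      intro x hx x' hx' hxx
      have e1 := hy x hx
      have e2 := hy x' hx'
      rw [← e2, hxx] at e1
      exact h.injective hα (mul_right_cancel₀ (hne _) e1)
    have hAc : (Finset.univ \ A).card = d - A.card := by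
      rw [Finset.card_sdiff_of_subset (Finset.subset_univ _), Finset.card_univ, Fintype.card_fin]
    have hAd : A.card ≤ d := by
      simpa using Finset.card_le_univ A
    have hbad1 : ((P t).filter fun x => x ∉ A).card ≤ d - A.card := by
      rw [← hAc]
      refine Finset.card_le_card fun x hx => ?_
      simpa using (Finset.mem_filter.1 hx).2
    have hbad2 : ((P t).filter fun x => y x ∉ A).card ≤ d - A.card := by
      rw [← hAc]
      refine Finset.card_le_card_of_injOn y (fun x hx => ?_) (hyinj.mono ?_)
      · simpa using (Finset.mem_filter.1 (Finset.mem_coe.1 hx)).2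
      · exact fun x hx => (Finset.mem_filter.1 (Finset.mem_coe.1 hx)).1
    -- Fewer than d/3 indices lie outside `A`. So fewer than d/3 of the x in `P t` are bad, and by
    -- injectivity of `y` fewer than d/3 have a bad partner, while `P t` has more than 2d/3
    -- elements.
    have hgood : ∃ x ∈ P t, x ∈ A ∧ y x ∈ A := by
      by_contra hcon
      push Not at hcon
      have hsub : P t ⊆ ((P t).filter fun x => x ∉ A) ∪ ((P t).filter fun x => y x ∉ A) := by
        intro x hx
        by_cases hxA : x ∈ A
        · exact Finset.mem_union_right _ (Finset.mem_filter.2 ⟨hx, hcon x hx hxA⟩)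
        · exact Finset.mem_union_left _ (Finset.mem_filter.2 ⟨hx, hxA⟩)
      have := (Finset.card_le_card hsub).trans (Finset.card_union_le _ _)
      omega
    obtain ⟨x, hx, hxA, hyA⟩ := hgood
    rw [← hy x hx, norm_mul, (Finset.mem_filter.1 hxA).2, (Finset.mem_filter.1 hyA).2, sq]
  have key := h.one_le_norm_prod hα (ι := Fin d × Fin d) (fun π t => (π t.1, π t.2))
    (fun π t t' htt => by
      simp only [Prod.mk.injEq, EmbeddingLike.apply_eq_iff_eq] at htt
      exact Prod.ext htt.1 htt.2)
    (fun t => MvPolynomial.X t.1 * MvPolynomial.X t.2) (fun π t => by simp) T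
    (fun π hπ t ht => by
      refine Finset.mem_filter.2 ⟨Finset.mem_univ _, ?_⟩
      refine lt_of_lt_of_le (Finset.mem_filter.1 ht).2 (Nat.mul_le_mul_left 3 ?_)
      refine Finset.card_le_card_of_injOn π (fun x hx => ?_) π.injective.injOn
      obtain ⟨y, hy⟩ := (Finset.mem_filter.1 (Finset.mem_coe.1 hx)).2
      refine Finset.mem_coe.2 (Finset.mem_filter.2 ⟨Finset.mem_univ _, π y, ?_⟩)
      have := (hπ (MvPolynomial.X x * MvPolynomial.X y
        - MvPolynomial.X t.1 * MvPolynomial.X t.2)).1 (by simp [hy])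
      simpa [sub_eq_zero] using this)
    (fun t _ => by simp [hne])
  simp only [map_mul, MvPolynomial.aeval_X] at key
  rw [Finset.prod_congr rfl hnorm, Finset.prod_const, ← pow_mul] at key
  by_contra hlt
  have hTpos : 0 < T.card := Finset.card_pos.2 ⟨_, hTne⟩
  exact absurd key (not_le.2 (pow_lt_one₀ hρ0 (not_le.1 hlt) (by positivity)))

end IsConjugateLabelling

/-! ### A Liouville inequality for differences of products of two conjugates -/

/-- Cyclic translations of `Fin d` permute the embeddings, so t(j) takes every value equally often.
-/
theorem sum_apply_embedding {r d : ℕ} (j : Fin r) (f : Fin d → ℝ) :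
    (d : ℝ) * ∑ t : Fin r ↪ Fin d, f (t j) = (d.descFactorial r : ℝ) * ∑ x, f x := by
  rcases Nat.eq_zero_or_pos d with rfl | hd
  · simp
  have : NeZero d := ⟨hd.ne'⟩
  have h1 : ∀ c : Fin d, ∑ t : Fin r ↪ Fin d, f (t j) = ∑ t : Fin r ↪ Fin d, f (t j + c) := by
    intro c
    exact (Equiv.sum_comp (Equiv.embeddingCongr (Equiv.refl (Fin r)) (Equiv.addRight c))
      (fun t : Fin r ↪ Fin d => f (t j))).symm.trans (Finset.sum_congr rfl fun t _ => by simp)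
  have h2 : ∑ _c : Fin d, ∑ t : Fin r ↪ Fin d, f (t j)
      = ∑ t : Fin r ↪ Fin d, ∑ c : Fin d, f (t j + c) := by
    rw [Finset.sum_congr rfl fun c _ => h1 c, Finset.sum_comm]
  have h3 : ∀ x : Fin d, ∑ c : Fin d, f (x + c) = ∑ y, f y := fun x =>
    Equiv.sum_comp (Equiv.addLeft x) f
  have h4 : ∑ t : Fin r ↪ Fin d, ∑ c : Fin d, f (t j + c) = ∑ _t : Fin r ↪ Fin d, ∑ y, f y :=
    Finset.sum_congr rfl fun t _ => h3 (t j)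
  rw [h4] at h2
  simpa [Fintype.card_embedding_eq] using h2

/-- A Liouville-type inequality: if many of the differences `a i * a j - a k * a l` of a given shape
are small and nonzero, then the Mahler measure is large. -/
theorem IsConjugateLabelling.card_mul_neg_log_le {α : ℂ} {d : ℕ} {a : Fin d → ℂ}
    (h : IsConjugateLabelling α a) (hα : IsIntegral ℤ α) {r : ℕ} (s : Fin 4 → Fin r)
    (S : Finset (Fin r ↪ Fin d)) {ε : ℝ}
    (hS0 : ∀ t ∈ S, a (t (s 0)) * a (t (s 1)) - a (t (s 2)) * a (t (s 3)) ≠ 0)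
    (hS : ∀ t ∈ S, ‖a (t (s 0)) * a (t (s 1)) - a (t (s 2)) * a (t (s 3))‖ ≤ ε) :
    (S.card : ℝ) * -Real.log ε ≤ d.descFactorial r * Real.log 2 +
      4 * ((d.descFactorial r : ℝ) / d) * ∑ i, Real.posLog ‖a i‖ := by
  classical
  let f : (Fin r ↪ Fin d) → ℂ := fun t =>
    a (t (s 0)) * a (t (s 1)) - a (t (s 2)) * a (t (s 3))
  -- All nonzero differences of the given shape: nonvanishing is preserved by Galois permutations,
  -- so their product is a nonzero integer. The factors in `S` are estimated by ε, the others
  -- trivially.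
  let T : Finset (Fin r ↪ Fin d) := Finset.univ.filter fun t => f t ≠ 0
  let u : (Fin r ↪ Fin d) → ℝ := fun t => Real.log 2 + (Real.posLog ‖a (t (s 0))‖ +
    Real.posLog ‖a (t (s 1))‖ + Real.posLog ‖a (t (s 2))‖ + Real.posLog ‖a (t (s 3))‖)
  have hlog2 : 0 < Real.log 2 := Real.log_pos (by norm_num)
  have hu0 : ∀ t, 0 ≤ u t := fun t => by
    have := fun j => Real.posLog_nonneg (x := ‖a (t (s j))‖)
    have h0 := this 0; have h1 := this 1; have h2 := this 2; have h3 := this 3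
    simp only [u]; linarith
  have hu : ∀ t, Real.log ‖f t‖ ≤ u t := by
    intro t
    have e1 : ‖f t‖ ≤ ‖a (t (s 0))‖ * ‖a (t (s 1))‖ + ‖a (t (s 2))‖ * ‖a (t (s 3))‖ := by
      refine (norm_sub_le _ _).trans ?_
      rw [norm_mul, norm_mul]
    have e2 := Real.posLog_le_posLog (norm_nonneg _) e1
    have e3 := Real.posLog_add (x := ‖a (t (s 0))‖ * ‖a (t (s 1))‖)
      (y := ‖a (t (s 2))‖ * ‖a (t (s 3))‖)
    have e4 := Real.posLog_mul (x := ‖a (t (s 0))‖) (y := ‖a (t (s 1))‖)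
    have e5 := Real.posLog_mul (x := ‖a (t (s 2))‖) (y := ‖a (t (s 3))‖)
    have e6 : Real.log ‖f t‖ ≤ Real.posLog ‖f t‖ := le_max_right _ _
    simp only [u]; linarith
  have key := h.one_le_norm_prod hα (ι := Fin r ↪ Fin d) (fun π t => t.trans π.toEmbedding)
    (fun π t t' htt => by
      ext x
      have := DFunLike.congr_fun htt x
      simpa [Fin.ext_iff] using this)
    (fun t => MvPolynomial.X (t (s 0)) * MvPolynomial.X (t (s 1))
      - MvPolynomial.X (t (s 2)) * MvPolynomial.X (t (s 3))) (fun π t => by simp) T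
    (fun π hπ t ht => by
      refine Finset.mem_filter.2 ⟨Finset.mem_univ _, fun hcon => (Finset.mem_filter.1 ht).2 ?_⟩
      have := (hπ (MvPolynomial.X (t (s 0)) * MvPolynomial.X (t (s 1))
        - MvPolynomial.X (t (s 2)) * MvPolynomial.X (t (s 3)))).2 (by simpa [f] using hcon)
      simpa [f] using this)
    (fun t ht => by simpa [f] using (Finset.mem_filter.1 ht).2)
  simp only [map_sub, map_mul, MvPolynomial.aeval_X] at key
  have hlog : 0 ≤ ∑ t ∈ T, Real.log ‖f t‖ := by
    rw [← Real.log_prod fun t ht => norm_ne_zero_iff.2 (Finset.mem_filter.1 ht).2]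
    exact Real.log_nonneg key
  have hST : S ⊆ T := fun t ht => Finset.mem_filter.2 ⟨Finset.mem_univ _, hS0 t ht⟩
  rw [← Finset.sum_sdiff hST] at hlog
  have hb1 : ∑ t ∈ S, Real.log ‖f t‖ ≤ S.card * Real.log ε := by
    rw [← nsmul_eq_mul]
    exact Finset.sum_le_card_nsmul _ _ _ fun t ht =>
      Real.log_le_log (norm_pos_iff.2 (hS0 t ht)) (hS t ht)
  have hb2 : ∑ t ∈ T \ S, Real.log ‖f t‖ ≤ ∑ t, u t :=
    (Finset.sum_le_sum fun t _ => hu t).trans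
      (Finset.sum_le_sum_of_subset_of_nonneg (Finset.subset_univ _) fun t _ _ => hu0 t)
  have hb3 : ∑ t, u t = d.descFactorial r * Real.log 2 +
      4 * ((d.descFactorial r : ℝ) / d) * ∑ i, Real.posLog ‖a i‖ := by
    have hj : ∀ j : Fin r, ∑ t : Fin r ↪ Fin d, Real.posLog ‖a (t j)‖
        = (d.descFactorial r : ℝ) / d * ∑ i, Real.posLog ‖a i‖ := by
      intro j
      have hd : (d : ℝ) ≠ 0 ∨ d = 0 := by
        rcases Nat.eq_zero_or_pos d with hd | hd
        · exact Or.inr hd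
        · exact Or.inl (by positivity)
      rcases hd with hd | rfl
      · have := sum_apply_embedding j fun x => Real.posLog ‖a x‖
        field_simp
        linarith
      · have : IsEmpty (Fin r ↪ Fin 0) := ⟨fun t => (t j).elim0⟩
        simp
    simp only [u, Finset.sum_add_distrib, hj, Finset.sum_const, Finset.card_univ,
      Fintype.card_embedding_eq, Fintype.card_fin, nsmul_eq_mul]
    ring
  linarith

/-! ### Test numbers from Eisenstein trinomials -/

theorem exists_isConjugateLabelling {α : ℂ} (hα : IsIntegral ℤ α) {d : ℕ}
    (hd : (minpoly ℚ α).natDegree = d) : ∃ a : Fin d → ℂ, IsConjugateLabelling α a := by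
  have hcard : ((minpoly ℚ α).aroots ℂ).toList.length = d := by
    rw [Multiset.length_toList, aroots_def,
      ← (IsAlgClosed.splits ((minpoly ℚ α).map (algebraMap ℚ ℂ))).natDegree_eq_card_roots,
      (minpoly.monic hα.tower_top).natDegree_map, hd]
  subst hcard
  set l := ((minpoly ℚ α).aroots ℂ).toList with hl
  let σ := Tuple.sort fun i => -‖l.get i‖
  refine ⟨fun i => l.get (σ i), ?_, ?_⟩
  · have h1 : (Finset.univ : Finset (Fin l.length)).val.map (fun i => l.get (σ i))
        = (Finset.univ : Finset (Fin l.length)).val.map l.get := by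
      conv_rhs => rw [← Multiset.map_univ_val_equiv σ, Multiset.map_map]
      rfl
    rw [h1, ← Multiset.coe_toList ((minpoly ℚ α).aroots ℂ), ← hl, Fin.univ_val_map,
      List.ofFn_get]
  · intro i j hij
    have := Tuple.monotone_sort (fun i => -‖l.get i‖) hij
    exact neg_le_neg_iff.1 this

/-- The Eisenstein trinomial `X ^ d + 2 n X ^ e + 2`. -/
noncomputable def testTrinomial (d e : ℕ) (n : ℤ) : ℤ[X] := X ^ d + C (2 * n) * X ^ e + C 2

theorem testTrinomial_degree_lt {d e : ℕ} (hed : e < d) (n : ℤ) :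
    (C (2 * n) * X ^ e + C 2 : ℤ[X]).degree < d := by
  refine (degree_add_le _ _).trans_lt (max_lt ?_ ?_)
  · exact (degree_C_mul_X_pow_le _ _).trans_lt (by exact_mod_cast hed)
  · exact degree_C_le.trans_lt (by exact_mod_cast (Nat.zero_le e).trans_lt hed)

theorem testTrinomial_monic {d e : ℕ} (hed : e < d) (n : ℤ) : (testTrinomial d e n).Monic := by
  rw [testTrinomial, add_assoc]
  exact monic_X_pow_add (testTrinomial_degree_lt hed n)

theorem testTrinomial_natDegree {d e : ℕ} (hed : e < d) (n : ℤ) :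
    (testTrinomial d e n).natDegree = d := by
  rw [testTrinomial, add_assoc]
  exact natDegree_eq_of_degree_eq_some (by
    rw [degree_add_eq_left_of_degree_lt] <;> rw [degree_X_pow]
    exact testTrinomial_degree_lt hed n)

theorem testTrinomial_irreducible {d e : ℕ} (he : 0 < e) (hed : e < d) (n : ℤ) :
    Irreducible (testTrinomial d e n) := by
  have hprime : (Ideal.span {(2 : ℤ)}).IsPrime := by
    rw [Ideal.span_singleton_prime (by norm_num)]; exact Int.prime_two
  have hE : (testTrinomial d e n).IsEisensteinAt (Ideal.span {(2 : ℤ)}) := by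
    refine ⟨?_, ?_, ?_⟩
    · rw [(testTrinomial_monic hed n).leadingCoeff, Ideal.mem_span_singleton]; norm_num
    · intro i hi
      rw [testTrinomial_natDegree hed] at hi
      rw [Ideal.mem_span_singleton, testTrinomial, coeff_add, coeff_add, coeff_X_pow,
        if_neg hi.ne, coeff_C_mul, zero_add, mul_assoc]
      refine dvd_add (dvd_mul_right _ _) ?_
      rw [coeff_C]
      split_ifs <;> simp
    · have h0 : (testTrinomial d e n).coeff 0 = 2 := by
        simp [testTrinomial, coeff_X_pow, he.ne, (he.trans hed).ne]
      rw [h0, Ideal.span_singleton_pow, Ideal.mem_span_singleton]; norm_num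
  exact hE.irreducible hprime (testTrinomial_monic hed n).isPrimitive
    (by rw [testTrinomial_natDegree hed]; omega)

theorem testTrinomial_root_bounds {d m : ℕ} (hm : 0 < m) (hmd : m < d) {n : ℤ} (hn : 3 ≤ n) {x : ℂ}
    (hx : aeval x (testTrinomial d (d - m) n) = 0) :
    (1 ≤ ‖x‖ → Real.log (2 * n - 2) / m ≤ Real.log ‖x‖ ∧
      Real.log ‖x‖ ≤ Real.log (2 * n + 2) / m) ∧
    (‖x‖ < 1 → -(Real.log (2 * n - 2) / (d - m : ℕ)) ≤ Real.log ‖x‖ ∧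
      Real.log ‖x‖ ≤ -(Real.log (n - 1 / 2) / (d - m : ℕ))) := by
  have hn' : (3 : ℝ) ≤ n := by exact_mod_cast hn
  have hdm : 0 < d - m := by omega
  have hm' : (0 : ℝ) < m := by exact_mod_cast hm
  have hdm' : (0 : ℝ) < (d - m : ℕ) := by exact_mod_cast hdm
  -- A root with |x| ≥ 1 makes x^m + 2n at most 2 in size; for |x| < 1 that factor lies between 2n -
  -- 1 and 2n + 1. The weaker bound 2n - 2 in the statement for small roots lets large and small
  -- roots be compared through the same logarithm.
  have heq : x ^ (d - m) * (x ^ m + 2 * n) = -2 := by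
    have h1 : aeval x (testTrinomial d (d - m) n) = x ^ d + 2 * n * x ^ (d - m) + 2 := by
      simp [testTrinomial, map_ofNat (aeval x) 2]
    rw [h1] at hx
    have h2 : x ^ d = x ^ (d - m) * x ^ m := by rw [← pow_add]; congr 1; omega
    rw [h2] at hx
    linear_combination hx
  have hnorm : ‖x‖ ^ (d - m) * ‖x ^ m + 2 * n‖ = 2 := by
    rw [← norm_pow, ← norm_mul, heq]; simp
  have h2n : ‖(2 * n : ℂ)‖ = 2 * n := by
    rw [norm_mul, Complex.norm_intCast, abs_of_nonneg (by linarith)]; simp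
  have hup : ‖x ^ m + 2 * n‖ ≤ ‖x‖ ^ m + 2 * n := by
    rw [← h2n, ← norm_pow]; exact norm_add_le _ _
  have hlow1 : 2 * n - ‖x‖ ^ m ≤ ‖x ^ m + 2 * n‖ := by
    rw [← h2n, ← norm_pow]
    have := norm_sub_norm_le (2 * n : ℂ) (-(x ^ m))
    rw [norm_neg, sub_neg_eq_add, add_comm (2 * n : ℂ)] at this
    exact this
  have hlow2 : ‖x‖ ^ m - 2 * n ≤ ‖x ^ m + 2 * n‖ := by
    rw [← h2n, ← norm_pow]
    have := norm_sub_norm_le (x ^ m) (-(2 * n : ℂ))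
    rwa [norm_neg, sub_neg_eq_add] at this
  constructor
  · intro h1
    have hpos : 0 < ‖x‖ := by linarith
    have h3 : 1 ≤ ‖x‖ ^ (d - m) := one_le_pow₀ h1
    have h4 : ‖x ^ m + 2 * n‖ ≤ 2 := by
      rw [← hnorm]; exact le_mul_of_one_le_left (norm_nonneg _) h3
    rw [div_le_iff₀ hm', le_div_iff₀ hm', mul_comm (Real.log ‖x‖), ← Real.log_pow]
    exact ⟨Real.log_le_log (by linarith) (by linarith),
      Real.log_le_log (by positivity) (by linarith)⟩
  · intro h1
    have hx0 : x ≠ 0 := by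
      rintro rfl
      rw [zero_pow hdm.ne', zero_mul] at heq
      norm_num at heq
    have hpos : 0 < ‖x‖ := norm_pos_iff.2 hx0
    have h3 : ‖x‖ ^ m ≤ 1 := pow_le_one₀ hpos.le h1.le
    have h5 : 0 < ‖x‖ ^ (d - m) := by positivity
    rw [← neg_div, ← neg_div, div_le_iff₀ hdm', le_div_iff₀ hdm', mul_comm (Real.log ‖x‖), ← Real.log_pow,
      ← Real.log_inv, ← Real.log_inv]
    constructor
    · apply Real.log_le_log (inv_pos.2 (by linarith))
      rw [inv_le_iff_one_le_mul₀ (by linarith)]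
      nlinarith
    · apply Real.log_le_log h5
      rw [le_inv_comm₀ h5 (by linarith), ← one_div, le_div_iff₀ h5]
      nlinarith

theorem exists_testConjugates {d m : ℕ} (hm : 0 < m) (hmd : m < d) {n : ℤ} (hn : 2 ^ m + 2 ≤ n) :
    ∃ (α : ℂ) (a : Fin d → ℂ), IsIntegral ℤ α ∧ (minpoly ℚ α).natDegree = d ∧
      IsConjugateLabelling α a ∧ (∀ i, a i ≠ 0) ∧
      (∀ i, Real.log ‖a i‖ ≤ Real.log (2 * n + 2) / m) ∧
      ∀ i : Fin d, m ≤ i → Real.log ‖a i‖ ≤ -(Real.log (n - 1 / 2) / (d - m : ℕ)) := by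
  have h2m : (1 : ℤ) ≤ 2 ^ m := one_le_pow₀ (by norm_num)
  have hn3 : 3 ≤ n := by linarith
  have hn' : (3 : ℝ) ≤ n := by exact_mod_cast hn3
  have hdm : 0 < d - m := by omega
  have hm' : (0 : ℝ) < m := by exact_mod_cast hm
  have hdm' : (0 : ℝ) < (d - m : ℕ) := by exact_mod_cast hdm
  have hed : d - m < d := by omega
  set q := testTrinomial d (d - m) n with hq
  have hmon := testTrinomial_monic hed n
  have hirr := testTrinomial_irreducible hdm hed n
  have hdeg := testTrinomial_natDegree hed n
  obtain ⟨α, hα0⟩ := IsAlgClosed.exists_aeval_eq_zero ℂ q (by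
    rw [degree_eq_natDegree hmon.ne_zero, hdeg]
    exact_mod_cast (hm.trans hmd).ne')
  have hα : IsIntegral ℤ α := ⟨q, hmon, hα0⟩
  have hminZ : q = minpoly ℤ α := by
    have h1 : (q.map (algebraMap ℤ ℚ)) = minpoly ℚ α := by
      refine minpoly.eq_of_irreducible_of_monic
        ((hmon.irreducible_iff_irreducible_map_fraction_map (K := ℚ)).1 hirr) ?_ (hmon.map _)
      rw [aeval_map_algebraMap, hα0]
    rw [minpoly.isIntegrallyClosed_eq_field_fractions' ℚ hα] at h1
    exact map_injective _ (algebraMap ℤ ℚ).injective_int h1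
  have hd : (minpoly ℚ α).natDegree = d := by
    rw [← IsConjugateLabelling.natDegree_minpoly_int hα, ← hminZ, hdeg]
  obtain ⟨a, ha⟩ := exists_isConjugateLabelling hα hd
  have hroot : ∀ i, aeval (a i) q = 0 := by
    intro i
    have := (ha.aeval_eq_zero_iff hα).2 ⟨i, rfl⟩
    rwa [minpoly.isIntegrallyClosed_eq_field_fractions' ℚ hα, aeval_map_algebraMap,
      ← hminZ] at this
  have hprod : ∏ i, ‖a i‖ = 2 := by
    have h1 := congrArg (eval 0) (ha.map_minpoly hα)
    rw [← hminZ, eval_prod] at h1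
    have h2 := congrArg norm h1
    rw [norm_prod] at h2
    simp only [eval_sub, eval_X, eval_C, zero_sub, norm_neg] at h2
    rw [← h2]
    simp [hq, testTrinomial, hdm.ne', (hm.trans hmd).ne']
  have hne : ∀ i, a i ≠ 0 := by
    intro i hi
    rw [Finset.prod_eq_zero (Finset.mem_univ i) (by simp [hi])] at hprod
    norm_num at hprod
  have hsum : ∑ i, Real.log ‖a i‖ = Real.log 2 := by
    rw [← hprod, Real.log_prod fun i _ => norm_ne_zero_iff.2 (hne i)]
  have hb := fun i => testTrinomial_root_bounds hm hmd hn3 (hroot i)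
  have hlA : m * Real.log 2 < Real.log (2 * n - 2) := by
    rw [← Real.log_pow]
    apply Real.log_lt_log (by positivity)
    have : (2 : ℝ) ^ m + 2 ≤ n := by exact_mod_cast hn
    linarith
  have hlog2 : 0 < Real.log 2 := Real.log_pos (by norm_num)
  have hlA0 : 0 < Real.log (2 * n - 2) := lt_of_le_of_lt (by positivity) hlA
  have hall : ∀ i, -(Real.log (2 * n - 2) / (d - m : ℕ)) ≤ Real.log ‖a i‖ := by
    intro i
    rcases lt_or_ge ‖a i‖ 1 with h1 | h1
    · exact ((hb i).2 h1).1
    · exact le_trans (by rw [neg_nonpos]; positivity) (Real.log_nonneg h1)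
  -- With L = log(2n - 2), having m + 1 conjugates outside the open unit disc would give ∑ log |a i|
  -- ≥ L/m + L/(d - m) > log 2, although the product of the absolute values is 2. The bound n ≥ 2^m
  -- + 2 ensures L/m > log 2.
  have hsmall : ∀ i : Fin d, m ≤ i → ‖a i‖ < 1 := by
    intro i hi
    by_contra hcon
    have hbig : ∀ j : Fin d, (j : ℕ) ≤ m → Real.log (2 * n - 2) / m ≤ Real.log ‖a j‖ := by
      intro j hj
      have hji : j ≤ i := Fin.le_def.2 (hj.trans hi)
      exact ((hb j).1 ((not_lt.1 hcon).trans (ha.antitone_norm hji))).1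
    have h1 : ∑ j : Fin d, (if (j : ℕ) ≤ m then Real.log (2 * n - 2) / m
        else -(Real.log (2 * n - 2) / (d - m : ℕ))) ≤ ∑ j, Real.log ‖a j‖ := by
      refine Finset.sum_le_sum fun j _ => ?_
      split_ifs with hj
      · exact hbig j hj
      · exact hall j
    have h2 : ∑ j : Fin d, (if (j : ℕ) ≤ m then Real.log (2 * n - 2) / m
        else -(Real.log (2 * n - 2) / (d - m : ℕ)))
        = (m + 1) * (Real.log (2 * n - 2) / m)
          - ((d - m : ℕ) - 1) * (Real.log (2 * n - 2) / (d - m : ℕ)) := by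
      rw [Fin.sum_univ_eq_sum_range (fun j => if j ≤ m then Real.log (2 * n - 2) / m
        else -(Real.log (2 * n - 2) / (d - m : ℕ))) d, Finset.range_eq_Ico,
        ← Finset.sum_Ico_consecutive _ (Nat.zero_le (m + 1)) (by omega : m + 1 ≤ d),
        Finset.sum_congr rfl (g := fun _ => Real.log (2 * n - 2) / m) (fun j hj => if_pos (by
          have := (Finset.mem_Ico.1 hj).2; omega)),
        Finset.sum_congr (s₁ := Finset.Ico (m + 1) d) rfl
          (g := fun _ => -(Real.log (2 * n - 2) / (d - m : ℕ)))
          (fun j hj => if_neg (by have := (Finset.mem_Ico.1 hj).1; omega))]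
      rw [Finset.sum_const, Finset.sum_const, Nat.card_Ico, Nat.card_Ico, nsmul_eq_mul,
        nsmul_eq_mul]
      have h3 : ((d - (m + 1) : ℕ) : ℝ) = (d - m : ℕ) - 1 := by
        rw [eq_sub_iff_add_eq]; exact_mod_cast (by omega : d - (m + 1) + 1 = d - m)
      rw [h3]
      push_cast
      ring
    rw [h2, hsum] at h1
    have h4 : (m : ℝ) * (Real.log (2 * n - 2) / m) = Real.log (2 * n - 2) := by field_simp
    have h5 : ((d - m : ℕ) : ℝ) * (Real.log (2 * n - 2) / (d - m : ℕ)) = Real.log (2 * n - 2) := by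
      field_simp
    have h6 : Real.log 2 < Real.log (2 * n - 2) / m := by
      rw [lt_div_iff₀ hm']; linarith
    have h7 : 0 < Real.log (2 * n - 2) / (d - m : ℕ) := by positivity
    nlinarith
  refine ⟨α, a, hα, hd, ha, hne, fun i => ?_, fun i hi => ((hb i).2 (hsmall i hi)).2⟩
  rcases lt_or_ge ‖a i‖ 1 with h1 | h1
  · exact (Real.log_nonpos (norm_nonneg _) h1.le).trans
      (div_nonneg (Real.log_nonneg (by linarith)) hm'.le)
  · exact ((hb i).1 h1).2

/-! ### Linear inequalities for the exponents, and Abel summation -/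

/-- The exponents `1, c₁, …, c_k` extended by zero. -/
def extendedExponent {k : ℕ} (c : Fin k → ℝ) : ℕ → ℝ
  | 0 => 1
  | j + 1 => if h : j < k then c ⟨j, h⟩ else 0

/-- The logarithms `log |a i|` extended by zero. -/
noncomputable def logNorm {d : ℕ} (a : Fin d → ℂ) (i : ℕ) : ℝ :=
  if h : i < d then Real.log ‖a ⟨i, h⟩‖ else 0

theorem logNorm_val {d : ℕ} (a : Fin d → ℂ) (i : Fin d) : logNorm a i = Real.log ‖a i‖ := by
  simp [logNorm]

theorem sum_range_logNorm {d : ℕ} (a : Fin d → ℂ) :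
    ∑ i ∈ Finset.range d, logNorm a i = ∑ i, Real.log ‖a i‖ := by
  rw [← Fin.sum_univ_eq_sum_range]
  exact Finset.sum_congr rfl fun i _ => logNorm_val a i

theorem logNorm_antitone {d : ℕ} {a : Fin d → ℂ} (ha : Antitone fun i => ‖a i‖)
    (h0 : ∀ i, a i ≠ 0) {i j : ℕ} (hij : i ≤ j) (hj : j < d) : logNorm a j ≤ logNorm a i := by
  rw [logNorm, logNorm, dif_pos hj, dif_pos (hij.trans_lt hj)]
  exact Real.log_le_log (norm_pos_iff.2 (h0 _)) (ha (Fin.le_def.2 hij))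

theorem extendedExponent_nonneg {k : ℕ} {c : Fin k → ℝ} (hc : ∀ j, 0 ≤ c j) (j : ℕ) :
    0 ≤ extendedExponent c j := by
  cases j with
  | zero => exact zero_le_one
  | succ j =>
    rw [extendedExponent]
    split_ifs
    · exact hc _
    · exact le_rfl

theorem weightedProduct_pos {k d : ℕ} (hkd : k < d) (c : Fin k → ℝ) {a : Fin d → ℂ}
    (h0 : ∀ i, a i ≠ 0) : 0 < weightedProduct hkd c a :=
  mul_pos (norm_pos_iff.2 (h0 _))
    (Finset.prod_pos fun _ _ => Real.rpow_pos_of_pos (norm_pos_iff.2 (h0 _)) _)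

theorem log_weightedProduct {k d : ℕ} (hkd : k < d) (c : Fin k → ℝ) {a : Fin d → ℂ}
    (h0 : ∀ i, a i ≠ 0) : Real.log (weightedProduct hkd c a) =
      ∑ j ∈ Finset.range (k + 1), extendedExponent c j * logNorm a j := by
  have hpos : ∀ i, 0 < ‖a i‖ := fun i => norm_pos_iff.2 (h0 i)
  rw [weightedProduct, Real.log_mul (hpos _).ne'
    (Finset.prod_ne_zero_iff.2 fun j _ => (Real.rpow_pos_of_pos (hpos _) _).ne'),
    Real.log_prod fun j _ => (Real.rpow_pos_of_pos (hpos _) _).ne',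
    Finset.sum_range_succ', ← Fin.sum_univ_eq_sum_range
      (fun j => extendedExponent c (j + 1) * logNorm a (j + 1)), add_comm]
  congr 1
  · refine Finset.sum_congr rfl fun j _ => ?_
    rw [Real.log_rpow (hpos _), extendedExponent, dif_pos j.2]
    exact congrArg _ (logNorm_val a (Fin.castLE hkd j.succ)).symm
  · rw [extendedExponent, one_mul]
    exact (logNorm_val a (Fin.castLE hkd 0)).symm

/-- The linear inequalities that define the polyhedron `E_{k,d}`. -/
theorem exponentSet_inequality {k d : ℕ} {hkd : k < d} {c : Fin k → ℝ} (hc : c ∈ exponentSet hkd)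
    {m : ℕ} (hmk : m ≤ k) :
    m * ∑ j ∈ Finset.range (k + 1), extendedExponent c j ≤
      d * ∑ j ∈ Finset.range m, extendedExponent c j := by
  rcases Nat.eq_zero_or_pos m with rfl | hm
  · simp
  have hmd : m < d := hmk.trans_lt hkd
  have hm' : (0 : ℝ) < m := by exact_mod_cast hm
  have hdm' : (0 : ℝ) < (d - m : ℕ) := by exact_mod_cast (by omega : 0 < d - m)
  have hdmc : ((d - m : ℕ) : ℝ) = d - m := by push_cast [hmd.le]; ring
  have hsplit : ∀ f : ℕ → ℝ, ∑ j ∈ Finset.range (k + 1), f j =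
      ∑ j ∈ Finset.range m, f j + ∑ j ∈ Finset.Ico m (k + 1), f j := fun f =>
    (Finset.sum_range_add_sum_Ico f (by omega)).symm
  rw [hsplit]
  set P := ∑ j ∈ Finset.range m, extendedExponent c j with hP
  set R := ∑ j ∈ Finset.Ico m (k + 1), extendedExponent c j with hR
  have hP0 : 0 ≤ P := Finset.sum_nonneg fun j _ => extendedExponent_nonneg hc.1 j
  have hR0 : 0 ≤ R := Finset.sum_nonneg fun j _ => extendedExponent_nonneg hc.1 j
  -- The 8 comes from 2n + 2 ≤ 8(n - 1/2). It disappears on dividing by log(n - 1/2) and letting n →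
  -- ∞, which leaves R/(d - m) ≤ P/m.
  have key : ∀ n : ℤ, 2 ^ m + 2 ≤ n →
      R * (Real.log (n - 1 / 2) / (d - m : ℕ)) ≤ P * ((Real.log 8 + Real.log (n - 1 / 2)) / m) := by
    intro n hn
    have h2m : (1 : ℤ) ≤ 2 ^ m := one_le_pow₀ (by norm_num)
    have hn' : (3 : ℝ) ≤ n := by exact_mod_cast (by linarith : 3 ≤ n)
    obtain ⟨α, a, hα, hd, ha, h0, hup, hlow⟩ := exists_testConjugates hm hmd hn
    have h1 := hc.2 α hα hd a ha
    have h2 := Real.log_nonneg h1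
    rw [log_weightedProduct hkd c h0, hsplit] at h2
    have h3 : ∑ j ∈ Finset.range m, extendedExponent c j * logNorm a j
        ≤ P * ((Real.log 8 + Real.log (n - 1 / 2)) / m) := by
      rw [hP, Finset.sum_mul]
      refine Finset.sum_le_sum fun j hj => ?_
      have hj' := Finset.mem_range.1 hj
      refine mul_le_mul_of_nonneg_left ?_ (extendedExponent_nonneg hc.1 j)
      rw [logNorm, dif_pos (by omega)]
      refine (hup _).trans ?_
      gcongr
      rw [← Real.log_mul (by norm_num) (by linarith)]
      exact Real.log_le_log (by linarith) (by linarith)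
    have h4 : ∑ j ∈ Finset.Ico m (k + 1), extendedExponent c j * logNorm a j
        ≤ R * -(Real.log (n - 1 / 2) / (d - m : ℕ)) := by
      rw [hR, Finset.sum_mul]
      refine Finset.sum_le_sum fun j hj => ?_
      have hj' := Finset.mem_Ico.1 hj
      refine mul_le_mul_of_nonneg_left ?_ (extendedExponent_nonneg hc.1 j)
      rw [logNorm, dif_pos (by omega)]
      exact hlow _ hj'.1
    linarith
  by_contra hcon
  have hδ : 0 < R / (d - m : ℕ) - P / m := by
    rw [sub_pos, div_lt_div_iff₀ hm' hdm', hdmc]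
    linarith
  obtain ⟨v, hv, hv8⟩ : ∃ n : ℤ, 2 ^ m + 2 ≤ n ∧
      P * Real.log 8 / m < (R / (d - m : ℕ) - P / m) * Real.log (n - 1 / 2) := by
    have ht : Filter.Tendsto (fun n : ℤ => (R / (d - m : ℕ) - P / m) * Real.log ((n : ℝ) - 1 / 2))
        Filter.atTop Filter.atTop :=
      (Real.tendsto_log_atTop.comp (Filter.tendsto_atTop_add_const_right _ (-(1 / 2 : ℝ))
        (tendsto_intCast_atTop_atTop (R := ℝ)))).const_mul_atTop hδ
    obtain ⟨n, hn⟩ := ((ht.eventually_gt_atTop (P * Real.log 8 / m)).and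
      (Filter.eventually_ge_atTop (2 ^ m + 2))).exists
    exact ⟨n, hn.2, hn.1⟩
  have := key v hv
  have e1 : P * ((Real.log 8 + Real.log (v - 1 / 2)) / m) = P * Real.log 8 / m
    + P / m * Real.log (v - 1 / 2) := by ring
  have e2 : R * (Real.log (v - 1 / 2) / (d - m : ℕ)) = R / (d - m : ℕ) * Real.log (v - 1 / 2) := by
    ring
  rw [e1, e2] at this
  linarith

/-- For exponents in `E_{k,d}`, the logarithm of the weighted product controls both the norm and the
spread of the smallest absolute values. -/
theorem sum_add_sub_le_log_weightedProduct {k d : ℕ} {hkd : k < d} {c : Fin k → ℝ}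
    (hc : c ∈ exponentSet hkd) {a : Fin d → ℂ} (ha : Antitone fun i => ‖a i‖)
    (h0 : ∀ i, a i ≠ 0) (hsum : 0 ≤ ∑ i, Real.log ‖a i‖) :
    ∑ i, Real.log ‖a i‖ + (logNorm a k - logNorm a (d - 1)) ≤
      d * Real.log (weightedProduct hkd c a) := by
  rw [log_weightedProduct hkd c h0]
  rw [← sum_range_logNorm] at hsum ⊢
  set x := logNorm a with hx
  set w := extendedExponent c with hw
  set W := ∑ j ∈ Finset.range (k + 1), w j with hW
  have hanti : ∀ {i j : ℕ}, i ≤ j → j < d → x j ≤ x i := fun hij hj =>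
    logNorm_antitone ha h0 hij hj
  have hW1 : 1 ≤ W := by
    rw [hW, Finset.sum_range_succ']
    have : 0 ≤ ∑ j ∈ Finset.range k, w (j + 1) :=
      Finset.sum_nonneg fun j _ => extendedExponent_nonneg hc.1 _
    have hw0 : w 0 = 1 := rfl
    linarith
  -- Abel summation: by `exponentSet_inequality` the partial sums of d w_j - W are nonnegative, and
  -- x is decreasing.
  have habel : ∀ n ≤ k, (d * ∑ j ∈ Finset.range (n + 1), w j - (n + 1) * W) * x n ≤
      ∑ j ∈ Finset.range (n + 1), (d * w j - W) * x j := by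
    intro n
    induction n with
    | zero => intro _; simp
    | succ n ih =>
      intro hn
      rw [Finset.sum_range_succ _ (n + 1), Finset.sum_range_succ _ (n + 1)]
      have h1 := ih (by omega)
      have h2 := exponentSet_inequality hc hn
      have h3 := hanti (Nat.le_succ n) (by omega)
      push_cast at h2 ⊢
      have h4 := mul_le_mul_of_nonneg_left h3 (sub_nonneg.2 h2)
      linarith
  have h1 := habel k le_rfl
  have h2 : ∑ j ∈ Finset.range (k + 1), (d * w j - W) * x j =
      d * ∑ j ∈ Finset.range (k + 1), w j * x j - W * ∑ j ∈ Finset.range (k + 1), x j := by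
    rw [Finset.mul_sum, Finset.mul_sum, ← Finset.sum_sub_distrib]
    exact Finset.sum_congr rfl fun j _ => by ring
  rw [h2] at h1
  have h3 := Finset.sum_range_add_sum_Ico x (by omega : k + 1 ≤ d)
  -- The right side is the sum of the nonnegative gaps x_k - x_j over j > k; only the last one is
  -- kept.
  have h4 : x k - x (d - 1) ≤ (d - (k + 1)) * x k - ∑ j ∈ Finset.Ico (k + 1) d, x j := by
    have e1 : ((d : ℝ) - (k + 1)) * x k = ∑ j ∈ Finset.Ico (k + 1) d, x k := by
      rw [Finset.sum_const, Nat.card_Ico, nsmul_eq_mul]; push_cast [show k + 1 ≤ d by omega]; ring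
    rw [e1, ← Finset.sum_sub_distrib]
    rcases (show k + 1 ≤ d by omega).eq_or_lt with hd | hd
    · rw [← hd]; simp
    · exact Finset.single_le_sum (f := fun j => x k - x j) (fun j hj => by
        have := Finset.mem_Ico.1 hj
        exact sub_nonneg.2 (hanti (by omega) this.2)) (Finset.mem_Ico.2 (by omega))
  have h5 : 0 ≤ x k - x (d - 1) := sub_nonneg.2 (hanti (by omega) (by omega))
  set U := (d - (k + 1)) * x k - ∑ j ∈ Finset.Ico (k + 1) d, x j with hU
  have h6 : W * (∑ j ∈ Finset.range d, x j + U) ≤ d * ∑ j ∈ Finset.range (k + 1), w j * x j := by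
    rw [← h3, hU]
    linarith
  nlinarith

/-! ### Counting pairs of conjugates with distinct absolute values -/

theorem muConst_pos {k d : ℕ} (h3 : 3 * k < d) : 0 < muConst k d := by
  rw [muConst, Int.lt_ceil]
  have h1 : (k : ℤ) < ⌈(d : ℚ) / 3⌉ := by
    rw [Int.lt_ceil, lt_div_iff₀ (by norm_num)]
    push_cast
    exact_mod_cast (by omega : k * 3 < d)
  have h2 : (k : ℚ) < (⌈(d : ℚ) / 3⌉ : ℚ) := by exact_mod_cast h1
  push_cast
  linarith

/-- This is the source of the outer ceiling in μ: non-real conjugates come in complex conjugate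
pairs, so the count n is even and n/2 is an integer. -/
theorem two_mul_muConst_le {k d n : ℕ} (hn : Even n) (h : d ≤ 3 * (n + k)) :
    2 * muConst k d ≤ n := by
  obtain ⟨q, rfl⟩ := hn
  have h1 : ⌈(d : ℚ) / 3⌉ ≤ ((q + q + k : ℕ) : ℤ) := by
    rw [Int.ceil_le, div_le_iff₀ (by norm_num)]
    exact_mod_cast (by omega : d ≤ (q + q + k) * 3)
  have h2 : (⌈(d : ℚ) / 3⌉ : ℚ) ≤ q + q + k := by exact_mod_cast h1
  have h3 : muConst k d ≤ q := by
    rw [muConst, Int.ceil_le]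
    push_cast
    linarith
  push_cast
  linarith

theorem Finset.even_card_of_involution {ι : Type*} (s : Finset ι) (τ : ι → ι)
    (hτ : ∀ i, τ (τ i) = i) (hs : ∀ i ∈ s, τ i ∈ s) (hne : ∀ i ∈ s, τ i ≠ i) : Even s.card := by
  rw [← ZMod.natCast_eq_zero_iff_even, Finset.card_eq_sum_ones, Nat.cast_sum]
  exact Finset.sum_involution (fun i _ => τ i) (fun _ _ => by decide) (fun i hi _ => hne i hi)
    (fun i hi => hs i hi) (fun i _ => hτ i)

theorem mainExponent_bounds {k d : ℕ} (h3 : 3 * k < d) (hk : 0 < k) :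
    2 ≤ mainExponent k d ∧ mainExponent k d ≤ 2 * (d : ℝ) ^ 3 := by
  have hd : (4 : ℝ) ≤ d := by exact_mod_cast (by omega : 4 ≤ d)
  have hμ : (1 : ℝ) ≤ muConst k d := by exact_mod_cast muConst_pos h3
  refine ⟨le_trans ?_ (le_max_left _ _), max_le ?_ ?_⟩
  · nlinarith
  · nlinarith [mul_nonneg (by linarith : (0 : ℝ) ≤ d) (by linarith : (0 : ℝ) ≤ d),
      pow_pos (by linarith : (0 : ℝ) < d) 3, sq_nonneg (d : ℝ)]
  · rw [div_le_iff₀ (by linarith)]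
    have e1 : ((d : ℝ) - 1) * (d - 2) * (d - 3) ≤ d * d * d := by
      gcongr <;> linarith
    have e2 : (d : ℝ) * d * d = d ^ 3 := by ring
    have e3 : 0 < (d : ℝ) ^ 3 := by positivity
    nlinarith

theorem cast_descFactorial_le {d r : ℕ} (hr : r ≤ 4) (hd : 0 < d) :
    ((d.descFactorial r : ℕ) : ℝ) ≤ (d : ℝ) ^ 4 := by
  exact_mod_cast (Nat.descFactorial_le_pow d r).trans (Nat.pow_le_pow_right hd hr)

/-- The Liouville inequality is applied to |a i|² - |a j|², whose shape depends on how many of a i,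
a j are real. With r distinct labels and s small differences the coefficient is 4(d-1)⋯(d-r+1)/s.
The three cases have (r, s) = (2, 1), (3, 2), (4, 8μ); the first two fall under 2(d-1)(d-2), and the
third gives the other term of the maximum. -/
theorem IsConjugateLabelling.neg_log_le {α : ℂ} {k d : ℕ} {a : Fin d → ℂ}
    (h : IsConjugateLabelling α a) (hα : IsIntegral ℤ α) (hk : 0 < k)
    (h3 : 3 * k < d) {M ε : ℝ} (hM : d - k ≤ (Finset.univ.filter fun i => ‖a i‖ ≤ M).card)
    (hclass : ∀ i, ‖a i‖ ≤ M → 3 * (Finset.univ.filter fun j => ‖a j‖ = ‖a i‖).card ≤ 2 * d)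
    (hε1 : ε ≤ 1)
    (hε : ∀ i j, ‖a i‖ ≤ M → ‖a j‖ ≤ M → |‖a i‖ ^ 2 - ‖a j‖ ^ 2| ≤ ε) :
    0 < ε ∧ -Real.log ε ≤ (d : ℝ) ^ 4 * Real.log 2 +
      mainExponent k d * ∑ i, Real.posLog ‖a i‖ := by
  classical
  set B := Finset.univ.filter fun i => ‖a i‖ ≤ M with hB
  have hmemB : ∀ i, i ∈ B ↔ ‖a i‖ ≤ M := fun i => by simp [hB]
  obtain ⟨τ, hτ⟩ := h.exists_conj hα
  have hinj := h.injective hα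
  have hττ : ∀ i, τ (τ i) = i := fun i => hinj (by rw [hτ, hτ, Complex.conj_conj])
  have hnτ : ∀ i, ‖a (τ i)‖ = ‖a i‖ := fun i => by rw [hτ, Complex.norm_conj]
  have hmul : ∀ i, a i * a (τ i) = ((‖a i‖ ^ 2 : ℝ) : ℂ) := fun i => by
    rw [hτ, Complex.mul_conj, Complex.normSq_eq_norm_sq]
  have hdiff : ∀ i j, ‖a i * a (τ i) - a j * a (τ j)‖ = |‖a i‖ ^ 2 - ‖a j‖ ^ 2| := fun i j => by
    rw [hmul, hmul, ← Complex.ofReal_sub, Complex.norm_real, Real.norm_eq_abs]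
  have hdiff0 : ∀ i j, ‖a i‖ ≠ ‖a j‖ → a i * a (τ i) - a j * a (τ j) ≠ 0 := fun i j hij => by
    rw [hmul, hmul, sub_ne_zero]
    intro hcon
    exact hij ((sq_eq_sq₀ (norm_nonneg _) (norm_nonneg _)).1 (Complex.ofReal_injective hcon))
  have hd4 : 4 ≤ d := by omega
  have hdR : (4 : ℝ) ≤ d := by exact_mod_cast hd4
  have hlog2 : 0 < Real.log 2 := Real.log_pos (by norm_num)
  set X := ∑ i, Real.posLog ‖a i‖ with hX
  have hX0 : 0 ≤ X := Finset.sum_nonneg fun i _ => Real.posLog_nonneg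
  -- `B` has at least d - k elements, and at most 2d/3 of them share the absolute value of a i.
  have hother : ∀ i ∈ B, d ≤ 3 * ((B.filter fun j => ‖a i‖ ≠ ‖a j‖).card + k) := by
    intro i hi
    have h1 : (B.filter fun j => ‖a i‖ = ‖a j‖).card + (B.filter fun j => ‖a i‖ ≠ ‖a j‖).card
        = B.card := Finset.card_filter_add_card_filter_not _
    have h2 : (B.filter fun j => ‖a i‖ = ‖a j‖).card ≤
        (Finset.univ.filter fun j => ‖a j‖ = ‖a i‖).card := by
      refine Finset.card_le_card fun j hj => ?_
      simp [(Finset.mem_filter.1 hj).2]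
    have h4 := hclass i ((hmemB i).1 hi)
    omega
  have hεpos : ∀ i j, i ∈ B → j ∈ B → ‖a i‖ ≠ ‖a j‖ → 0 < ε := fun i j hi hj hij => by
    refine lt_of_lt_of_le (norm_pos_iff.2 (hdiff0 i j hij)) ?_
    rw [hdiff]
    exact hε i j ((hmemB i).1 hi) ((hmemB j).1 hj)
  have hlogε : 0 < ε → 0 ≤ -Real.log ε := fun hpos => by
    have := Real.log_nonpos hpos.le hε1
    linarith
  have hmax1 : 2 * ((d : ℝ) - 1) * (d - 2) ≤ mainExponent k d := le_max_left _ _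
  by_cases hreal : ∃ i ∈ B, τ i = i
  · obtain ⟨i, hi, hτi⟩ := hreal
    have hcard := hother i hi
    obtain ⟨j, hj⟩ : (B.filter fun j => ‖a i‖ ≠ ‖a j‖).Nonempty := by
      rw [← Finset.card_pos]; omega
    obtain ⟨hjB, hij⟩ := Finset.mem_filter.1 hj
    have hpos := hεpos i j hi hjB hij
    have hij' : i ≠ j := fun hcon => hij (by rw [hcon])
    refine ⟨hpos, ?_⟩
    by_cases hτj : τ j = j
    · let S : Finset (Fin 2 ↪ Fin d) := Finset.univ.filter fun t => t 0 = i ∧ t 1 = j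
      have hS1 : 1 ≤ S.card := by
        refine Finset.card_pos.2 ⟨⟨![i, j], ?_⟩, ?_⟩
        · intro x y hxy
          fin_cases x <;> fin_cases y <;> simp_all
        · exact Finset.mem_filter.2 ⟨Finset.mem_univ _, rfl, rfl⟩
      have key := h.card_mul_neg_log_le hα ![0, 0, 1, 1] S (ε := ε)
        (fun t ht => by
          obtain ⟨h1, h2⟩ := (Finset.mem_filter.1 ht).2
          have := hdiff0 i j hij
          rw [hτi, hτj] at this
          simpa [h1, h2] using this)
        (fun t ht => by
          obtain ⟨h1, h2⟩ := (Finset.mem_filter.1 ht).2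
          have := (hdiff i j).le.trans (hε i j ((hmemB i).1 hi) ((hmemB j).1 hjB))
          rw [hτi, hτj] at this
          simpa [h1, h2] using this)
      have hN : ((d.descFactorial 2 : ℕ) : ℝ) = d * (d - 1) := by
        rw [Nat.cast_descFactorial_two]
      have hNd : ((d.descFactorial 2 : ℕ) : ℝ) / d = d - 1 := by
        rw [hN]; field_simp
      have hS1' : (1 : ℝ) ≤ S.card := by exact_mod_cast hS1
      have hle := cast_descFactorial_le (d := d) (r := 2) (by norm_num) (by omega)
      rw [hNd] at key
      have e1 := mul_le_mul_of_nonneg_right hS1' (hlogε hpos)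
      have e2 := mul_le_mul_of_nonneg_right hle hlog2.le
      have e3 : 4 * ((d : ℝ) - 1) * X ≤ mainExponent k d * X :=
        mul_le_mul_of_nonneg_right (by nlinarith) hX0
      linarith
    -- A real a i against a non-real a j: exchanging j and τ j gives two embeddings with the same
    -- small difference.
    · let S : Finset (Fin 3 ↪ Fin d) := Finset.univ.filter fun t =>
        t 0 = i ∧ (t 1 = j ∨ t 1 = τ j) ∧ t 2 = τ (t 1)
      have hiτj : i ≠ τ j := fun hcon => hij (by rw [hcon, hnτ])
      have hS2 : 2 ≤ S.card := by
        rw [← Finset.card_pair (Ne.symm hτj)]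
        refine Finset.card_le_card_of_surjOn (fun t => t 1) ?_
        intro y hy
        have hy' : y = j ∨ y = τ j := by simpa using hy
        have hyi : i ≠ y ∧ i ≠ τ y ∧ y ≠ τ y := by
          rcases hy' with rfl | rfl
          · exact ⟨hij', hiτj, Ne.symm hτj⟩
          · rw [hττ]; exact ⟨hiτj, hij', hτj⟩
        refine ⟨⟨![i, y, τ y], ?_⟩, ?_, ?_⟩
        · obtain ⟨h1, h2, h4⟩ := hyi
          intro x z hxz
          fin_cases x <;> fin_cases z <;> simp_all
        · exact Finset.mem_coe.2 (Finset.mem_filter.2 ⟨Finset.mem_univ _, rfl, hy', rfl⟩)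
        · rfl
      have hval : ∀ t ∈ S, a (t 0) * a (t 0) - a (t 1) * a (t 2)
          = a i * a (τ i) - a (t 1) * a (τ (t 1)) ∧ ‖a (t 1)‖ = ‖a j‖ := by
        intro t ht
        obtain ⟨h1, h2, h4⟩ := (Finset.mem_filter.1 ht).2
        refine ⟨by rw [h1, h4, hτi], ?_⟩
        rcases h2 with h2 | h2 <;> rw [h2]
        exact hnτ j
      have key := h.card_mul_neg_log_le hα ![0, 0, 1, 2] S (ε := ε)
        (fun t ht => by
          obtain ⟨h1, h2⟩ := hval t ht
          have := hdiff0 i (t 1) (by rw [h2]; exact hij)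
          rw [← h1] at this
          simpa using this)
        (fun t ht => by
          obtain ⟨h1, h2⟩ := hval t ht
          have := (hdiff i (t 1)).le.trans
            (hε i (t 1) ((hmemB i).1 hi) (by rw [h2]; exact (hmemB j).1 hjB))
          rw [← h1] at this
          simpa using this)
      have hN : ((d.descFactorial 3 : ℕ) : ℝ) / d = (d - 1) * (d - 2) := by
        have : ((d.descFactorial 3 : ℕ) : ℝ) = d * ((d - 1) * (d - 2)) := by
          simp only [Nat.descFactorial_succ, Nat.descFactorial_zero, Nat.sub_zero]
          push_cast [show 2 ≤ d by omega, show 1 ≤ d by omega]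
          ring
        rw [this]; field_simp
      have hS2' : (2 : ℝ) ≤ S.card := by exact_mod_cast hS2
      have hle := cast_descFactorial_le (d := d) (r := 3) (by norm_num) (by omega)
      rw [hN] at key
      have e1 := mul_le_mul_of_nonneg_right hS2' (hlogε hpos)
      have e2 := mul_le_mul_of_nonneg_right hle hlog2.le
      have e3 := mul_le_mul_of_nonneg_right hmax1 hX0
      have e4 : 0 ≤ (d : ℝ) ^ 4 * Real.log 2 := by positivity
      linarith
  · push Not at hreal
    have hBτ : ∀ i ∈ B, τ i ∈ B := fun i hi => by rw [hmemB, hnτ]; exact (hmemB i).1 hi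
    have hBeven : Even B.card := B.even_card_of_involution τ hττ hBτ hreal
    -- Here d - k > 2k ≥ 2, so `B` has at least 3 elements, and its cardinality is even.
    have hB4 : 4 ≤ B.card := by
      obtain ⟨q, hq⟩ := hBeven
      omega
    have hμ := muConst_pos h3
    let T : Finset (Σ _ : Fin d, Fin d) := B.sigma fun i => B.filter fun j => ‖a i‖ ≠ ‖a j‖
    -- At least 4 choices of i, each with at least 2μ choices of j.
    have hT : 8 * muConst k d ≤ T.card := by
      have h1 : ∀ i ∈ B, 2 * muConst k d ≤ ((B.filter fun j => ‖a i‖ ≠ ‖a j‖).card : ℤ) := by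
        intro i hi
        refine two_mul_muConst_le ?_ (hother i hi)
        refine Finset.even_card_of_involution _ τ hττ (fun j hj => ?_) (fun j hj => ?_)
        · obtain ⟨h1, h2⟩ := Finset.mem_filter.1 hj
          exact Finset.mem_filter.2 ⟨hBτ j h1, by rw [hnτ]; exact h2⟩
        · exact hreal j (Finset.mem_filter.1 hj).1
      rw [Finset.card_sigma, Nat.cast_sum]
      have h2 := Finset.card_nsmul_le_sum B _ _ h1
      rw [nsmul_eq_mul] at h2
      have h4 : (4 : ℤ) ≤ B.card := by exact_mod_cast hB4
      nlinarith
    have hTne : T.Nonempty := by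
      rw [← Finset.card_pos]; omega
    obtain ⟨⟨i₁, j₁⟩, hp⟩ := hTne
    obtain ⟨hi₁, hj₁⟩ := Finset.mem_sigma.1 hp
    have hpos := hεpos i₁ j₁ hi₁ (Finset.mem_filter.1 hj₁).1 (Finset.mem_filter.1 hj₁).2
    refine ⟨hpos, ?_⟩
    let S : Finset (Fin 4 ↪ Fin d) := Finset.univ.filter fun t =>
      t 1 = τ (t 0) ∧ t 3 = τ (t 2) ∧ t 0 ∈ B ∧ t 2 ∈ B ∧ ‖a (t 0)‖ ≠ ‖a (t 2)‖
    have hTS : T.card ≤ S.card := by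
      refine Finset.card_le_card_of_surjOn (fun t => ⟨t 0, t 2⟩) ?_
      rintro ⟨i, j⟩ hij
      obtain ⟨hi, hj⟩ := Finset.mem_sigma.1 (Finset.mem_coe.1 hij)
      obtain ⟨hj, hne⟩ := Finset.mem_filter.1 hj
      dsimp only at hi hj hne
      have h1 : τ i ≠ i := hreal i hi
      have h2 : τ j ≠ j := hreal j hj
      have h4 : i ≠ j := fun hcon => hne (by rw [hcon])
      have h5 : i ≠ τ j := fun hcon => hne (by rw [hcon, hnτ])
      have h6 : τ i ≠ j := fun hcon => hne (by rw [← hcon, hnτ])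
      have h7 : τ i ≠ τ j := fun hcon => h4 (τ.injective hcon)
      refine ⟨⟨![i, τ i, j, τ j], ?_⟩, ?_, ?_⟩
      · have h1' := h1.symm
        have h2' := h2.symm
        have h4' := h4.symm
        have h5' := h5.symm
        have h6' := h6.symm
        have h7' := h7.symm
        intro x z hxz
        fin_cases x <;> fin_cases z <;> first | rfl | exact absurd hxz (by assumption)
      · exact Finset.mem_coe.2
          (Finset.mem_filter.2 ⟨Finset.mem_univ _, rfl, rfl, hi, hj, hne⟩)
      · rfl
    have key := h.card_mul_neg_log_le hα ![0, 1, 2, 3] S (ε := ε)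
      (fun t ht => by
        obtain ⟨h1, h2, h4, h5, h6⟩ := (Finset.mem_filter.1 ht).2
        have := hdiff0 _ _ h6
        rw [← h1, ← h2] at this
        simpa using this)
      (fun t ht => by
        obtain ⟨h1, h2, h4, h5, h6⟩ := (Finset.mem_filter.1 ht).2
        have := (hdiff (t 0) (t 2)).le.trans (hε _ _ ((hmemB _).1 h4) ((hmemB _).1 h5))
        rw [← h1, ← h2] at this
        simpa using this)
    have hN : ((d.descFactorial 4 : ℕ) : ℝ) / d = (d - 1) * (d - 2) * (d - 3) := by
      have : ((d.descFactorial 4 : ℕ) : ℝ) = d * ((d - 1) * (d - 2) * (d - 3)) := by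
        simp only [Nat.descFactorial_succ, Nat.descFactorial_zero, Nat.sub_zero]
        push_cast [show 3 ≤ d by omega, show 2 ≤ d by omega, show 1 ≤ d by omega]
        ring
      rw [this]; field_simp
    have hS : 8 * (muConst k d : ℝ) ≤ S.card := by
      exact_mod_cast hT.trans (by exact_mod_cast hTS)
    have hμ' : (1 : ℝ) ≤ muConst k d := by exact_mod_cast hμ
    have hle := cast_descFactorial_le (d := d) (r := 4) le_rfl (by omega)
    rw [hN] at key
    have hmax2 : ((d : ℝ) - 1) * (d - 2) * (d - 3) / (2 * (muConst k d : ℝ)) ≤ mainExponent k d :=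
      le_max_right _ _
    rw [div_le_iff₀ (by linarith)] at hmax2
    have e1 := mul_le_mul_of_nonneg_right hS (hlogε hpos)
    have e2 := mul_le_mul_of_nonneg_right hle hlog2.le
    have e3 := mul_le_mul_of_nonneg_right hmax2 hX0
    have e4 : 0 ≤ (d : ℝ) ^ 4 * Real.log 2 := by positivity
    have e5 : (d : ℝ) ^ 4 * Real.log 2 ≤ 8 * (muConst k d : ℝ) * ((d : ℝ) ^ 4 * Real.log 2) :=
      le_mul_of_one_le_left e4 (by linarith)
    have e6 : 8 * (muConst k d : ℝ) * -Real.log ε ≤ 8 * (muConst k d : ℝ) *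
        ((d : ℝ) ^ 4 * Real.log 2 + mainExponent k d * X) := by linarith
    exact le_of_mul_le_mul_left e6 (by linarith)

/-! ### The spread of the small conjugates of a unit -/

/-- A lower bound for the spread of the `d - k` smallest absolute values of the conjugates of a
unit. -/
theorem IsConjugateLabelling.spread_trichotomy {α : ℂ} {k d : ℕ} {a : Fin d → ℂ}
    (h : IsConjugateLabelling α a) (hα : IsIntegral ℤ α) (h0 : α ≠ 0) (hk : 0 < k)
    (h3 : 3 * k < d) (hS : ∑ i, Real.log ‖a i‖ = 0) :
    ∑ i, Real.posLog ‖a i‖ ≤ d * (logNorm a k - logNorm a (d - 1)) ∨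
    1 / 4 < logNorm a k - logNorm a (d - 1) ∨
    (0 < logNorm a k - logNorm a (d - 1) ∧
      -Real.log (4 * (logNorm a k - logNorm a (d - 1))) - 2 * logNorm a (d - 1) ≤
        (d : ℝ) ^ 4 * Real.log 2 + mainExponent k d * ∑ i, Real.posLog ‖a i‖ ∧
      ∑ i, Real.posLog ‖a i‖ ≤ -(d * logNorm a (d - 1))) := by
  set r := logNorm a (d - 1) with hr
  set g := logNorm a k - r with hg
  have hne := h.ne_zero hα h0
  have hpos : ∀ i, 0 < ‖a i‖ := fun i => norm_pos_iff.2 (hne i)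
  have hkd : k < d := by omega
  let kk : Fin d := ⟨k, hkd⟩
  have hkk : Real.log ‖a kk‖ = r + g := by
    rw [← logNorm_val]; simp only [hg, kk]; ring
  have hrle : ∀ i, r ≤ Real.log ‖a i‖ := fun i => by
    rw [← logNorm_val]
    exact logNorm_antitone h.antitone_norm hne (by omega) (by omega)
  have hg0 : 0 ≤ g := by
    have := hrle kk
    linarith
  have hd0 : (0 : ℝ) < d := by exact_mod_cast (by omega : 0 < d)
  have hr0 : r ≤ 0 := by
    have h1 : ∑ _i : Fin d, r ≤ ∑ i, Real.log ‖a i‖ := Finset.sum_le_sum fun i _ => hrle i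
    rw [hS, Finset.sum_const, Finset.card_univ, Fintype.card_fin, nsmul_eq_mul] at h1
    by_contra hcon
    have := mul_pos hd0 (not_le.1 hcon)
    linarith
  -- Since r ≤ 0 is the least logarithm, each positive part is at most log |a i| - r, and the
  -- logarithms sum to zero.
  have hX : ∑ i, Real.posLog ‖a i‖ ≤ -(d * r) := by
    have h1 : ∑ i, Real.posLog ‖a i‖ ≤ ∑ i, (Real.log ‖a i‖ - r) :=
      Finset.sum_le_sum fun i _ => by
        have := hrle i
        exact max_le (by linarith) (by linarith)
    rw [Finset.sum_sub_distrib, hS, Finset.sum_const, Finset.card_univ, Fintype.card_fin,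
      nsmul_eq_mul] at h1
    linarith
  by_cases hpop : ∃ i, ‖a i‖ ≤ ‖a kk‖ ∧
      2 * d < 3 * (Finset.univ.filter fun j => ‖a j‖ = ‖a i‖).card
  · left
    obtain ⟨i, hi, hcard⟩ := hpop
    have h1 := h.one_le_of_card_norm_eq hα h0 hcard
    have h2 := Real.log_nonneg (h1.trans hi)
    rw [hkk] at h2
    refine hX.trans ?_
    rw [← mul_neg]
    exact mul_le_mul_of_nonneg_left (by linarith) hd0.le
  right
  push Not at hpop
  rcases lt_or_ge (1 / 4) g with hg4 | hg4
  · exact Or.inl hg4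
  right
  have hexp : ∀ i, ‖a i‖ ^ 2 = Real.exp (2 * Real.log ‖a i‖) := fun i => by
    rw [two_mul, Real.exp_add, Real.exp_log (hpos i), sq]
  have hbound : ∀ i, ‖a i‖ ≤ ‖a kk‖ →
      Real.exp (2 * r) ≤ ‖a i‖ ^ 2 ∧ ‖a i‖ ^ 2 ≤ Real.exp (2 * r) * (1 + 4 * g) := by
    intro i hi
    rw [hexp]
    constructor
    · have := hrle i
      exact Real.exp_le_exp.2 (by linarith)
    · have h1 := Real.log_le_log (hpos i) hi
      rw [hkk] at h1
      have h2 := Real.abs_exp_sub_one_le (x := 2 * g) (by rw [abs_of_nonneg] <;> linarith)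
      rw [abs_of_nonneg (by linarith : 0 ≤ 2 * g)] at h2
      have h3 := (abs_le.1 h2).2
      calc Real.exp (2 * Real.log ‖a i‖) ≤ Real.exp (2 * r + 2 * g) :=
            Real.exp_le_exp.2 (by linarith)
        _ = Real.exp (2 * r) * Real.exp (2 * g) := Real.exp_add _ _
        _ ≤ Real.exp (2 * r) * (1 + 4 * g) :=
            mul_le_mul_of_nonneg_left (by linarith) (Real.exp_pos _).le
  have hexp1 : Real.exp (2 * r) ≤ 1 := Real.exp_le_one_iff.2 (by linarith)
  -- The relevant squares lie in an interval of length 4g exp(2r), by |exp(2g) - 1| ≤ 4g. Keeping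
  -- the factor exp(2r) is what later improves the exponent; g ≤ 1/4 gives ε ≤ 1.
  obtain ⟨hεpos, hlog⟩ := h.neg_log_le hα hk h3 (M := ‖a kk‖) (ε := Real.exp (2 * r) * (4 * g))
    (by
      have : (Finset.Ici kk).card = d - k := Fin.card_Ici kk
      rw [← this]
      refine Finset.card_le_card fun i hi => ?_
      exact Finset.mem_filter.2 ⟨Finset.mem_univ _, h.antitone_norm (Finset.mem_Ici.1 hi)⟩)
    (fun i hi => hpop i hi)
    (mul_le_one₀ hexp1 (by linarith) (by linarith))
    (fun i j hi hj => by
      have h1 := hbound i hi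
      have h2 := hbound j hj
      rw [abs_le]
      constructor <;> linarith)
  have hgpos : 0 < 4 * g := pos_of_mul_pos_right hεpos (Real.exp_pos _).le
  refine ⟨by linarith, ?_, hX⟩
  rw [Real.log_mul (Real.exp_pos _).ne' hgpos.ne', Real.log_exp] at hlog
  linarith

/-! ### The lower bound in terms of the height -/

theorem mainTheorem2 (d : ℕ) :
    ∃ C : ℝ, 0 < C ∧
      ∀ (k : ℕ) (_hk : 0 < k) (_h3 : 3 * k < d) (hkd : k < d)
        (α : ℂ), IsIntegral ℤ α → (minpoly ℚ α).natDegree = d →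
        (∀ n : ℕ, 0 < n → α ^ n ≠ 1) →
        ∀ a : Fin d → ℂ, IsConjugateLabelling α a →
        ∀ c ∈ exponentSet hkd,
          1 + C * (polyHeight (minpoly ℤ α) : ℝ) ^
              (-mainExponent k d + 1 / ((k : ℝ) * ((d : ℝ) - 1)))
            < weightedProduct hkd c a := by
  obtain ⟨δ, hδ, hgap⟩ := IsConjugateLabelling.exists_sum_posLog_gap d
  have hlog2 : 0 < Real.log 2 := Real.log_pos (by norm_num)
  set κ := Real.log (√((d : ℝ) + 1)) with hκ
  have hκ0 : 0 ≤ κ := Real.log_nonneg (Real.one_le_sqrt.2 (by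
    have : (0 : ℝ) ≤ d := by positivity
    linarith))
  set K := (d : ℝ) ^ 4 * Real.log 2 + Real.log 4 + 2 * (d : ℝ) ^ 3 * κ with hK
  -- One term per case: a crowded circle, a spread above 1/4, a non-unit, and the Liouville
  -- estimate.
  set C₁ := min (min (δ / (d + 1)) (1 / 4)) (min (Real.log 2) (Real.exp (-K))) with hC₁
  have hC₁pos : 0 < C₁ := by
    refine lt_min (lt_min (by positivity) (by norm_num)) (lt_min hlog2 (Real.exp_pos _))
  have hC1a : C₁ ≤ δ / (d + 1) := (min_le_left _ _).trans (min_le_left _ _)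
  have hC1b : C₁ ≤ 1 / 4 := (min_le_left _ _).trans (min_le_right _ _)
  have hC1c : C₁ ≤ Real.log 2 := (min_le_right _ _).trans (min_le_left _ _)
  have hC1d : C₁ ≤ Real.exp (-K) := (min_le_right _ _).trans (min_le_right _ _)
  -- The choice of d + 1 keeps the constant meaningful for d = 0; the factor 2 makes the final
  -- inequality strict.
  refine ⟨C₁ / (2 * (d + 1)), by positivity, ?_⟩
  intro k hk h3 hkd α hα hd hroot a ha c hc
  have h0 : α ≠ 0 := by
    rintro rfl
    rw [minpoly.zero, natDegree_X] at hd
    omega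
  have hne := ha.ne_zero hα h0
  have hdR : (4 : ℝ) ≤ d := by exact_mod_cast (by omega : 4 ≤ d)
  have hkR : (1 : ℝ) ≤ k := by exact_mod_cast hk
  have hH : (1 : ℝ) ≤ polyHeight (minpoly ℤ α) := by
    exact_mod_cast IsConjugateLabelling.one_le_polyHeight hα
  set H : ℝ := (polyHeight (minpoly ℤ α) : ℝ) with hHdef
  have hh := Real.log_nonneg hH
  obtain ⟨hE2, hE3⟩ := mainExponent_bounds h3 hk
  set E := mainExponent k d with hEdef
  -- The argument really saves 2/d in the exponent; the stated saving is weaker.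
  have hfrac : 1 / ((k : ℝ) * (d - 1)) ≤ 2 / d := by
    rw [div_le_div_iff₀ (by nlinarith) (by linarith)]
    nlinarith
  have h2d : 2 / (d : ℝ) ≤ 1 := by rw [div_le_one (by linarith)]; linarith
  set e := -E + 1 / ((k : ℝ) * (d - 1)) with he
  have hHe1 : H ^ e ≤ 1 := Real.rpow_le_one_of_one_le_of_nonpos hH (by linarith)
  have hHe0 : 0 < H ^ e := Real.rpow_pos_of_pos (by linarith) _
  set g := logNorm a k - logNorm a (d - 1) with hg
  have hg0 : 0 ≤ g :=
    sub_nonneg.2 (logNorm_antitone ha.antitone_norm hne (by omega) (by omega))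
  have hC1H : C₁ * H ^ e ≤ C₁ := mul_le_of_le_one_right hC₁pos.le hHe1
  have hmain : C₁ * H ^ e ≤ ∑ i, Real.log ‖a i‖ + g := by
    rcases ha.sum_log_norm hα h0 with hS | hS
    swap
    · linarith
    rw [hS, zero_add]
    have hX0 := hgap α hα h0 hd hroot a ha
    have hXh := ha.sum_posLog_le_log_polyHeight hα hd
    set X := ∑ i, Real.posLog ‖a i‖ with hX
    rcases ha.spread_trichotomy hα h0 hk h3 hS with h1 | h1 | ⟨hgpos, h1, h2⟩
    · have : δ / (d + 1) ≤ g := by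
        rw [div_le_iff₀ (by linarith)]
        nlinarith
      linarith
    · linarith
    · rw [Real.log_mul (by norm_num) hgpos.ne'] at h1
      have h4 : 2 / (d : ℝ) * X ≤ -(2 * logNorm a (d - 1)) := by
        rw [div_mul_eq_mul_div, div_le_iff₀ (by linarith)]
        linarith
      have h5 : (E - 2 / d) * X ≤ (E - 2 / d) * (Real.log H + κ) :=
        mul_le_mul_of_nonneg_left hXh (by linarith)
      have h6 : (E - 2 / d) * Real.log H ≤ -e * Real.log H :=
        mul_le_mul_of_nonneg_right (by linarith) hh
      have h7 : (E - 2 / d) * κ ≤ 2 * (d : ℝ) ^ 3 * κ := by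
        refine mul_le_mul_of_nonneg_right ?_ hκ0
        have : 0 < 2 / (d : ℝ) := by positivity
        linarith
      have h8 : -K + Real.log H * e ≤ Real.log g := by
        rw [hK]
        linarith
      have h9 := Real.exp_le_exp.2 h8
      rw [Real.exp_log hgpos, Real.exp_add, ← Real.rpow_def_of_pos (by linarith)] at h9
      exact (mul_le_mul_of_nonneg_right hC1d hHe0.le).trans h9
  have hsum0 : 0 ≤ ∑ i, Real.log ‖a i‖ := by
    rcases ha.sum_log_norm hα h0 with hS | hS <;> linarith
  have hlower := hmain.trans (sum_add_sub_le_log_weightedProduct hc ha.antitone_norm hne hsum0)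
  have hwp := weightedProduct_pos hkd c hne
  have hfin : Real.log (weightedProduct hkd c a) ≤ weightedProduct hkd c a - 1 :=
    Real.log_le_sub_one_of_pos hwp
  have hCH : 0 < C₁ * H ^ e := mul_pos hC₁pos hHe0
  have hlt : C₁ / (2 * (d + 1)) * H ^ e < Real.log (weightedProduct hkd c a) := by
    rw [div_mul_eq_mul_div, div_lt_iff₀ (by linarith)]
    have hlogpos : 0 < Real.log (weightedProduct hkd c a) := by
      by_contra hcon
      have := mul_nonpos_of_nonneg_of_nonpos (by linarith : (0 : ℝ) ≤ d) (not_lt.1 hcon)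
      linarith
    nlinarith
  linarith
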